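/- **Model.** An MC-IS network with $n$ common nodes: the nodes are independent and uniformly distributed on the unit square, and every node is the source of one flow, whose destination is chosen independently and uniformly among the other nodes; all flows carry the same traffic. Two nodes are one hop apart if their distance is at most the transmission range $r(n)$, where $\beta_1\sqrt{\log n/n}\le r(n)\le\beta_2\sqrt{\log n/n}$ with constants $0<\beta_1\le\beta_2$. There are $b=b_0^2$ base stations, at the centres of the $b$ equal square cells of the unit square, connected by a wired network without delay. Each base station has $m$ interfaces ($m\ge 2$ even), half of them for the uplink and half for the downlink, and $C_I\ge 1$ channels are dedicated to infrastructure communications; simultaneous transmissions at a base station use different interfaces and different channels. Under the $H$-max-hop routing strategy ($H=H(n)\ge 1$) a packet is sent in the ad hoc mode, along a path with the fewest hops, if its destination is within $H$ hops of its source; otherwise it goes by uplink to the base station nearest to the source, through the wired network, and by downlink from the base station nearest to the destination. Assume that the fraction of sources in the ad hoc mode stays away from one, in the form $\pi H^2r(n)^2\le 1-\varepsilon$ for a constant $\varepsilon>0$ and all large $n$. A packet spends a constant time $c_1>0$ per ad hoc hop. Let $c>0$ be the time per packet (one uplink and one downlink transmission) of base stations that carry out one transmission at a time; in general an uplink or downlink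 transmission takes the least average time per transmission that a base station needs when it carries out equally many uplink and downlink transmissions in slots of length $c/2$, each transmission occupying one interface of its direction and one channel for one slot. Queueing is not counted. The average delay $D$ is the average of the packet delays over all $n$ flows; $D_a$ and $D_i$ are the parts of this average that come from the packets in the ad hoc mode and in the infrastructure mode. **Theorem 2.** $D=D_a+D_i$, and both with high probability (probability tending to $1$ as $n\to\infty$) and in expectation $$D_a=\Theta\Big(\frac{H^3\log n}{n}\Big),\qquad D_i=\Theta\Big(\frac{c}{\min\{C_I,m\}}\Big),\qquad D=\Theta\Big(\frac{H^3\log n}{n}\Big)+\Theta\Big(\frac{c}{\min\{C_I,m\}}\Big),$$ where the implied constants depend only on $\beta_1,\beta_2,\varepsilon,c_1$. Moreover, the number of sources in the ad hoc mode is $\Theta(H^2\log n)$ with high probability and in expectation; the number of hops of a packet in the ad hoc mode is $\Theta(H)$, in (conditional) expectation and, with high probability, on average over these packets; the maximal number of simultaneous transmissions of a base station is $\min\{C_I,m\}$; and every packet in the infrastructure mode has delay $c/\min\{C_I,m\}$. -/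

import Mathlib

open MeasureTheory ProbabilityTheory Filter Topology

namespace MCIS

/-- The Euclidean plane. -/
abbrev Plane : Type := EuclideanSpace ℝ (Fin 2)

/-- The region in which the network is deployed. -/
def unitSquare : Set Plane := {x | ∀ i, x i ∈ Set.Icc (0 : ℝ) 1}

/-- A realization of the random network: the position of every common node, and for every node
(each node is the source of one flow) its destination node. -/
abbrev Config (n : ℕ) : Type := (Fin n → Plane) × (Fin n → Fin n)

/-- The law of the random network with `n` common nodes: the positions are independent and uniform
on the unit square, and, independently of them, every node chooses its destination uniformly and
independently among the other nodes (the uniform law on the maps without a fixed point). -/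
noncomputable def law (n : ℕ) : Measure (Config n) :=
  (Measure.pi fun _ : Fin n => (volume : Measure Plane).restrict unitSquare).prod
    (uniformOn {d : Fin n → Fin n | ∀ i, d i ≠ i})

/-- Two distinct nodes are one hop apart when they are within the common transmission range. -/
def hopGraph {n : ℕ} (r : ℝ) (X : Fin n → Plane) : SimpleGraph (Fin n) where
  Adj i j := i ≠ j ∧ dist (X i) (X j) ≤ r
  symm := ⟨fun _ _ h => ⟨h.1.symm, by rw [dist_comm]; exact h.2⟩⟩
  loopless := ⟨fun _ h => h.1 rfl⟩

/-! ### Base stations -/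

/-- The base stations: the centres of the `b₀ ^ 2` equal square cells of the unit square. -/
def baseStations (b₀ : ℕ) : Set Plane :=
  {p | ∃ u v : Fin b₀, p = !₂[((u : ℝ) + 1 / 2) / b₀, ((v : ℝ) + 1 / 2) / b₀]}

/-- A base station that is closest to the point `x`. -/
noncomputable def nearestBS (b₀ : ℕ) (x : Plane) : Plane :=
  Classical.epsilon fun p => p ∈ baseStations b₀ ∧ ∀ q ∈ baseStations b₀, dist x p ≤ dist x q

/-- A transmission plan of one base station with `m` interfaces (half of them serve the uplink, half
the downlink) and `CI` infrastructure channels. It carries out a family `J` of transmissions with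
pairwise different nodes, uplink or downlink according to `dir`, within `L` slots. Every transmission
occupies one interface of its direction and one channel during one slot; transmissions of the same
slot share no channel (they would interfere) and no interface. -/
structure BSPlan (m CI L : ℕ) {J : Type} (dir : J → Bool) where
  slot : J → Fin L
  interface : J → Fin (m / 2)
  channel : J → Fin CI
  channel_ne : ∀ x y, x ≠ y → slot x = slot y → channel x ≠ channel y
  interface_ne : ∀ x y, x ≠ y → slot x = slot y → dir x = dir y → interface x ≠ interface y

/-- `k` simultaneous transmissions (one slot) are possible at a base station. -/
def CanSupport (m CI k : ℕ) : Prop :=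
  ∃ dir : Fin k → Bool, Nonempty (BSPlan m CI 1 dir)

/-- The time a base station needs per transmission when a slot lasts `τ`: the least value of
(duration of a plan) / (number of transmissions carried out), over all plans that carry out equally
many uplink and downlink transmissions. Packets are a fluid, and waiting in queues is not counted. -/
noncomputable def transmissionTime (τ : ℝ) (m CI : ℕ) : ℝ :=
  sInf {t : ℝ | ∃ N L : ℕ, 0 < N ∧
    Nonempty (BSPlan m CI L (fun x : Bool × Fin N => x.1)) ∧ t = τ * L / (2 * N)}

/-! ### Routing -/

/-- One leg of the route of a packet. -/
inductive Leg (n : ℕ) : Type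
  | adHoc (i j : Fin n)
  | uplink (i : Fin n) (B : Plane)
  | wired (B B' : Plane)
  | downlink (B : Plane) (j : Fin n)

/-- The destination of the flow from `i` is within `H` hops of `i`. -/
def IsAdHoc {n : ℕ} (H : ℕ) (r : ℝ) (ω : Config n) (i : Fin n) : Prop :=
  ∃ p : (hopGraph r ω.1).Walk i (ω.2 i), p.length ≤ H

/-- The number of hops from the source `i` to its destination. -/
noncomputable def hops {n : ℕ} (r : ℝ) (ω : Config n) (i : Fin n) : ℕ :=
  (hopGraph r ω.1).dist i (ω.2 i)

/-- Some path with the fewest hops between two nodes that are joined by a path. -/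
noncomputable def shortestWalk {n : ℕ} {G : SimpleGraph (Fin n)} {i j : Fin n}
    (h : G.Reachable i j) : G.Walk i j :=
  h.exists_walk_length_eq_dist.choose

open Classical in
/-- The `H`-max-hop routing strategy: multi-hop ad hoc transmission if the destination is within `H`
hops, otherwise uplink to the base station nearest to the source, the wired network, and downlink
from the base station nearest to the destination. -/
noncomputable def route {n : ℕ} (H : ℕ) (r : ℝ) (b₀ : ℕ) (ω : Config n) (i : Fin n) :
    List (Leg n) :=
  if h : IsAdHoc H r ω i then
    (shortestWalk ⟨h.choose⟩).darts.map fun e => Leg.adHoc e.fst e.snd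
  else
    [Leg.uplink i (nearestBS b₀ (ω.1 i)),
     Leg.wired (nearestBS b₀ (ω.1 i)) (nearestBS b₀ (ω.1 (ω.2 i))),
     Leg.downlink (nearestBS b₀ (ω.1 (ω.2 i))) (ω.2 i)]

/-! ### Delay -/

/-- The parameters of a network, apart from the number of common nodes. -/
structure Params where
  /-- maximal number of ad hoc hops -/
  H : ℕ
  /-- transmission range of the common nodes -/
  r : ℝ
  /-- the network has `b₀ ^ 2` base stations -/
  b₀ : ℕ
  /-- number of interfaces of a base station -/
  m : ℕ
  /-- number of channels dedicated to infrastructure communications -/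
  CI : ℕ
  /-- time that a packet spends per ad hoc hop -/
  c₁ : ℝ
  /-- time per packet (one uplink and one downlink transmission) of base stations that can carry out
  only one transmission at a time; hence a single transmission takes `c / 2` -/
  c : ℝ

/-- The time spent on one leg; the wired network causes no delay. -/
noncomputable def legDelay {n : ℕ} (P : Params) : Leg n → ℝ
  | Leg.adHoc _ _ => P.c₁
  | Leg.uplink _ _ => transmissionTime (P.c / 2) P.m P.CI
  | Leg.wired _ _ => 0
  | Leg.downlink _ _ => transmissionTime (P.c / 2) P.m P.CI

/-- The delay of the packets of the flow that starts at node `i`. -/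
noncomputable def packetDelay {n : ℕ} (P : Params) (ω : Config n) (i : Fin n) : ℝ :=
  ((route P.H P.r P.b₀ ω i).map (legDelay P)).sum

open Classical in
/-- The sources that transmit in the ad hoc mode. -/
noncomputable def adHocSources {n : ℕ} (P : Params) (ω : Config n) : Finset (Fin n) :=
  Finset.univ.filter fun i => IsAdHoc P.H P.r ω i

/-- The average delay of all packets; all `n` flows carry the same traffic. -/
noncomputable def avgDelay {n : ℕ} (P : Params) (ω : Config n) : ℝ :=
  (∑ i, packetDelay P ω i) / n

/-- The part of the average delay contributed by ad hoc communications. -/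
noncomputable def avgDelayAdHoc {n : ℕ} (P : Params) (ω : Config n) : ℝ :=
  (∑ i ∈ adHocSources P ω, packetDelay P ω i) / n

/-- The part of the average delay contributed by infrastructure communications. -/
noncomputable def avgDelayInfra {n : ℕ} (P : Params) (ω : Config n) : ℝ :=
  (∑ i ∈ (adHocSources P ω)ᶜ, packetDelay P ω i) / n

/-- The average number of hops of the packets that are transmitted in the ad hoc mode. -/
noncomputable def avgHops {n : ℕ} (P : Params) (ω : Config n) : ℝ :=
  (∑ i ∈ adHocSources P ω, (hops P.r ω i : ℝ)) / (adHocSources P ω).card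

/-- The expected number of hops of the packets of source `i`, given that they are transmitted in
the ad hoc mode. -/
noncomputable def expectedHops {n : ℕ} (P : Params) (i : Fin n) : ℝ :=
  ∫ ω, (hops P.r ω i : ℝ) ∂(cond (law n) {ω | IsAdHoc P.H P.r ω i})

/-- `x` is of order `y`, with the constants `k` and `K`. -/
def Between (k K x y : ℝ) : Prop := k * y ≤ x ∧ x ≤ K * y

end MCIS

/-! A base station uses distinct (slot, channel) and distinct (slot, direction, interface) triples
for its transmissions, so `q = min CI m` per slot is an upper bound. A two-slot schedule with
alternating directions attains it, hence an infrastructure packet takes `c / q`. Writing `s` for the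
number of ad hoc sources, `D_i = (n - s) / n * c / q` and `D_a = c₁ * (total ad hoc hops) / n`.
Everything reduces to showing that `s` has order `H² log n`, that `s ≤ (1 - ε/2) n`, and that the
hops average to order `H`.

Upper bounds on `s`. A destination within `H` hops is within distance `H r`, an event of probability
at most `π (H r)²`. Two trips without a common end are independent and common ends have probability
`O(1/n)`, so Chebyshev's inequality concentrates the count of near destinations
(`law_real_count_near_ge_le`). The same count at radius `δ H r` is at most `s / 2` for small `δ`;
the other ad hoc sources need at least `δ H` hops (`mul_sub_le_sum_adHocHops`).

Lower bound on `s` (`exists_card_adHocSources_lower`). Given the positions, destinations are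
independent, so it suffices to have order `n * n (H r)²` ordered pairs within `H` hops
(`law_real_card_adHocSources_le`). Cut the square into cells of side `1 / M` with `3 ≤ M r ≤ 4`, so
that nodes in touching cells are one hop apart. When `β₁` is small, some cells may well be empty, so
direct routing through all cells is not available. Instead, take blocks of `2K × 2K` cells with `K`
a large constant: with high probability no block has `K` empty cells, so adjacent blocks share a
fully occupied row or column, and these lines join up into paths of length proportional to the
distance of the blocks. By Markov's inequality at least half of the nodes also lie in completely
occupied blocks, hence on such lines. Grouping `D × D` blocks with `D` proportional to `H` makes
these nodes mutually reachable within each group, and Cauchy–Schwarz over the groups counts the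
pairs (`sq_card_le_reachCount`). For bounded `H`, pairs inside one cell are enough.

Expectations: lower bounds follow from the probable orders and Markov's inequality, upper bounds
from the near probability. Exchangeability of the nodes transfers the total number of hops to one
source (`expectedHops`). -/

namespace MCIS

/-! ### Base stations -/

/-- A transmission is determined by its slot and channel, and also by its slot, direction and
interface. Evenness of `m` makes `2 * (m / 2)` equal to `m`. -/
theorem BSPlan.card_le {m CI L : ℕ} {J : Type} [Fintype J] {dir : J → Bool}
    (hm : Even m) (p : BSPlan m CI L dir) : Fintype.card J ≤ L * min CI m := by
  have h1 : Fintype.card J ≤ L * CI := by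
    have := Fintype.card_le_of_injective (fun x => (p.slot x, p.channel x)) (by
      intro x y hxy
      by_contra hne
      simp only [Prod.mk.injEq] at hxy
      exact p.channel_ne x y hne hxy.1 hxy.2)
    simpa using this
  have h2 : Fintype.card J ≤ L * m := by
    have := Fintype.card_le_of_injective (fun x => (p.slot x, dir x, p.interface x)) (by
      intro x y hxy
      by_contra hne
      simp only [Prod.mk.injEq] at hxy
      exact p.interface_ne x y hne hxy.1 hxy.2.1 hxy.2.2)
    have h3 : 2 * (m / 2) = m := Nat.two_mul_div_two_of_even hm
    simp only [Fintype.card_prod, Fintype.card_fin, Fintype.card_bool, h3] at this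
    exact this
  rcases min_choice CI m with h | h <;> rw [h] <;> assumption

theorem isGreatest_canSupport {m CI : ℕ} (hm : Even m) :
    IsGreatest {s | CanSupport m CI s} (min CI m) := by
  constructor
  -- Direction by parity, interface by half the index: the two together recover the index.
  · refine ⟨fun k => decide (k.1 % 2 = 0), ⟨⟨fun _ => 0, fun k => ⟨k.1 / 2, ?_⟩,
      fun k => ⟨k.1, lt_of_lt_of_le k.2 (min_le_left _ _)⟩, ?_, ?_⟩⟩⟩
    · have h := lt_of_lt_of_le k.2 (min_le_right _ _)
      obtain ⟨a, ha⟩ := hm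
      omega
    · intro x y hxy _ h
      apply hxy
      simpa [Fin.ext_iff] using h
    · intro x y hxy _ hd h
      apply hxy
      simp only [decide_eq_decide, Fin.mk.injEq] at hd h
      ext
      omega
  · rintro k ⟨dir, ⟨p⟩⟩
    simpa using p.card_le hm

theorem transmissionTime_eq {m CI : ℕ} (hm : Even m) (hm1 : 1 ≤ m) (hCI : 1 ≤ CI) {τ : ℝ}
    (hτ : 0 ≤ τ) : transmissionTime τ m CI = τ / (min CI m : ℕ) := by
  have hq : 0 < min CI m := lt_min hCI hm1
  have hq' : (0 : ℝ) < (min CI m : ℕ) := by exact_mod_cast hq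
  refine IsLeast.csInf_eq ⟨⟨min CI m, 2, hq, ⟨?_⟩, ?_⟩, ?_⟩
  -- In one slot the even indices go in one direction and the odd ones in the other; the second slot
  -- swaps the roles. Each slot then carries `min CI m` transmissions, and the directions balance
  -- even when this number is odd.
  · refine ⟨fun x => if (x.1 = true ↔ x.2.1 % 2 = 0) then 0 else 1, fun x => ⟨x.2.1 / 2, ?_⟩,
      fun x => ⟨x.2.1, lt_of_lt_of_le x.2.2 (min_le_left _ _)⟩, ?_, ?_⟩
    · have h := lt_of_lt_of_le x.2.2 (min_le_right _ _)
      obtain ⟨a, ha⟩ := hm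
      omega
    · rintro ⟨b, x⟩ ⟨b', y⟩ hxy hs h
      simp only [Fin.mk.injEq] at h
      have hx : x = y := Fin.ext h
      subst hx
      apply hxy
      rcases b <;> rcases b' <;> simp at hs ⊢ <;> split_ifs at hs <;> simp_all
    · rintro ⟨b, x⟩ ⟨b', y⟩ hxy hs hd h
      simp only at hd
      subst hd
      apply hxy
      simp only [Fin.mk.injEq] at h
      have hx : x = y := by
        ext
        rcases b <;> simp at hs <;> split_ifs at hs <;> simp_all <;> omega
      rw [hx]
  · push_cast
    field_simp
  · rintro t ⟨N, L, hN, ⟨p⟩, rfl⟩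
    have h := p.card_le hm
    simp only [Fintype.card_prod, Fintype.card_bool, Fintype.card_fin] at h
    have h' : (2 * N : ℝ) ≤ L * (min CI m : ℕ) := by exact_mod_cast h
    have hN' : (0 : ℝ) < 2 * N := by positivity
    rw [div_le_div_iff₀ hq' hN', mul_assoc]
    gcongr

/-! ### Delay of a packet -/

theorem packetDelay_infra {n : ℕ} {P : Params} {ω : Config n} {i : Fin n} (hm : Even P.m)
    (hm1 : 1 ≤ P.m) (hCI : 1 ≤ P.CI) (hc : 0 ≤ P.c) (h : ¬ IsAdHoc P.H P.r ω i) :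
    packetDelay P ω i = P.c / (min P.CI P.m : ℕ) := by
  unfold packetDelay route
  rw [dif_neg h]
  simp only [List.map_cons, List.map_nil, List.sum_cons, List.sum_nil, legDelay]
  rw [transmissionTime_eq hm hm1 hCI (by linarith)]
  ring

theorem packetDelay_adHoc {n : ℕ} {P : Params} {ω : Config n} {i : Fin n}
    (h : IsAdHoc P.H P.r ω i) : packetDelay P ω i = P.c₁ * hops P.r ω i := by
  have key : ∀ (hr : (hopGraph P.r ω.1).Reachable i (ω.2 i)),
      (shortestWalk hr).length = hops P.r ω i := fun hr =>
    hr.exists_walk_length_eq_dist.choose_spec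
  unfold packetDelay route
  rw [dif_pos h, ← key ⟨h.choose⟩]
  simp only [List.map_map, Function.comp_def, legDelay, List.map_const', List.sum_replicate,
    SimpleGraph.Walk.length_darts, nsmul_eq_mul]
  ring

theorem hops_le {n : ℕ} {H : ℕ} {r : ℝ} {ω : Config n} {i : Fin n} (h : IsAdHoc H r ω i) :
    hops r ω i ≤ H := by
  obtain ⟨p, hp⟩ := h
  exact (SimpleGraph.dist_le p).trans hp

theorem avgDelay_eq {n : ℕ} (P : Params) (ω : Config n) :
    avgDelay P ω = avgDelayAdHoc P ω + avgDelayInfra P ω := by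
  unfold avgDelay avgDelayAdHoc avgDelayInfra
  rw [← add_div, Finset.sum_add_sum_compl]

theorem avgDelayAdHoc_eq {n : ℕ} (P : Params) (ω : Config n) :
    avgDelayAdHoc P ω = P.c₁ * (∑ i ∈ adHocSources P ω, (hops P.r ω i : ℝ)) / n := by
  unfold avgDelayAdHoc
  rw [Finset.mul_sum]
  congr 1
  refine Finset.sum_congr rfl fun i hi => packetDelay_adHoc ?_
  simpa [adHocSources] using hi

theorem avgDelayInfra_eq {n : ℕ} {P : Params} {ω : Config n} (hm : Even P.m)
    (hm1 : 1 ≤ P.m) (hCI : 1 ≤ P.CI) (hc : 0 ≤ P.c) :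
    avgDelayInfra P ω = (n - (adHocSources P ω).card) / n * (P.c / (min P.CI P.m : ℕ)) := by
  unfold avgDelayInfra
  rw [Finset.sum_congr rfl fun i hi => packetDelay_infra hm hm1 hCI hc (by
    simpa [adHocSources] using hi), Finset.sum_const, nsmul_eq_mul, Finset.card_compl,
    Nat.cast_sub (Finset.card_le_univ _), Fintype.card_fin]
  ring

/-- Nodes joined by a path of length at most `H` are at distance at most `H * r`. -/
theorem dist_le_of_walk {n : ℕ} {r : ℝ} {X : Fin n → Plane} {i j : Fin n}
    (p : (hopGraph r X).Walk i j) : dist (X i) (X j) ≤ p.length * r := by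
  induction p with
  | nil => simp
  | @cons u v w h p ih =>
    calc dist (X u) (X w) ≤ dist (X u) (X v) + dist (X v) (X w) := dist_triangle _ _ _
      _ ≤ r + p.length * r := add_le_add h.2 ih
      _ = _ := by rw [SimpleGraph.Walk.length_cons]; push_cast; ring

theorem dist_le_of_isAdHoc {n : ℕ} {H : ℕ} {r : ℝ} {ω : Config n} {i : Fin n}
    (h : IsAdHoc H r ω i) : dist (ω.1 i) (ω.1 (ω.2 i)) ≤ hops r ω i * r ∧ hops r ω i ≤ H := by
  refine ⟨?_, hops_le h⟩
  obtain ⟨q, hq⟩ := (SimpleGraph.Walk.reachable h.choose).exists_walk_length_eq_dist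
  have := dist_le_of_walk q
  rwa [hq] at this

theorem one_le_hops {n : ℕ} {H : ℕ} {r : ℝ} {ω : Config n} {i : Fin n}
    (h : IsAdHoc H r ω i) (hi : ω.2 i ≠ i) : 1 ≤ hops r ω i :=
  (SimpleGraph.Walk.reachable h.choose).pos_dist_of_ne hi.symm

/-! ### Counting events -/

section Counting

variable {Ω ι : Type*} [MeasurableSpace Ω] [Fintype ι]

theorem integrable_indicator_one {P : Measure Ω} [IsFiniteMeasure P] {s : Set Ω}
    (hs : MeasurableSet s) : Integrable (s.indicator fun _ => (1 : ℝ)) P :=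
  (integrable_const _).indicator hs

theorem integral_indicator_const_one {P : Measure Ω} {s : Set Ω} (hs : MeasurableSet s) :
    ∫ ω, s.indicator (fun _ => (1 : ℝ)) ω ∂P = P.real s := by
  rw [integral_indicator hs]
  simp [Measure.real]

/-- Chebyshev's inequality for the number of events that occur. -/
theorem measureReal_abs_count_sub_ge {P : Measure Ω} [IsProbabilityMeasure P] {E : ι → Set Ω}
    (hE : ∀ i, MeasurableSet (E i)) {V t : ℝ} (ht : 0 < t)
    (hV : ∑ i, ∑ k, P.real (E i ∩ E k) ≤ (∑ i, P.real (E i)) ^ 2 + V) :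
    P.real {ω | t ≤ |∑ i, (E i).indicator (fun _ => (1 : ℝ)) ω - ∑ i, P.real (E i)|} ≤
      V / t ^ 2 := by
  set S := ∑ i, P.real (E i)
  set Z : Ω → ℝ := fun ω => ∑ i, (E i).indicator (fun _ => (1 : ℝ)) ω with hZ
  have hZint : Integrable Z P := integrable_finsetSum _ fun i _ => integrable_indicator_one (hE i)
  have hZS : ∫ ω, Z ω ∂P = S := by
    rw [hZ, integral_finsetSum _ fun i _ => integrable_indicator_one (hE i)]
    exact Finset.sum_congr rfl fun i _ => integral_indicator_const_one (hE i)
  have hsq : ∀ ω, Z ω ^ 2 =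
      ∑ i, ∑ k, (E i ∩ E k).indicator (fun _ => (1 : ℝ)) ω := by
    intro ω
    simp only [hZ, sq, Finset.sum_mul_sum]
    refine Finset.sum_congr rfl fun i _ => Finset.sum_congr rfl fun k _ => ?_
    by_cases h1 : ω ∈ E i <;> by_cases h2 : ω ∈ E k <;> simp [h1, h2]
  have hI : ∀ i k, Integrable ((E i ∩ E k).indicator fun _ => (1 : ℝ)) P := fun i k =>
    integrable_indicator_one ((hE i).inter (hE k))
  have hsqint : Integrable (fun ω => Z ω ^ 2) P := by
    simp only [hsq]
    exact integrable_finsetSum _ fun i _ => integrable_finsetSum _ fun k _ => hI i k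
  have hsqval : ∫ ω, Z ω ^ 2 ∂P = ∑ i, ∑ k, P.real (E i ∩ E k) := by
    simp only [hsq]
    rw [integral_finsetSum _ fun i _ => integrable_finsetSum _ fun k _ => hI i k]
    refine Finset.sum_congr rfl fun i _ => ?_
    rw [integral_finsetSum _ fun k _ => hI i k]
    exact Finset.sum_congr rfl fun k _ =>
      integral_indicator_const_one ((hE i).inter (hE k))
  have hdev : (fun ω => (Z ω - S) ^ 2) = fun ω => Z ω ^ 2 - 2 * S * Z ω + S ^ 2 := by
    ext ω; ring
  have hdevint : Integrable (fun ω => (Z ω - S) ^ 2) P := by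
    rw [hdev]
    exact (hsqint.sub (hZint.const_mul _)).add (integrable_const _)
  have hvar : ∫ ω, (Z ω - S) ^ 2 ∂P ≤ V := by
    have h1 : Integrable (fun ω => Z ω ^ 2 - 2 * S * Z ω) P := hsqint.sub (hZint.const_mul _)
    rw [hdev, integral_add h1 (integrable_const _),
      integral_sub hsqint (hZint.const_mul _), integral_const_mul, hZS, hsqval]
    simp only [integral_const, probReal_univ, smul_eq_mul, one_mul]
    linarith
  have hmk := mul_meas_ge_le_integral_of_nonneg (μ := P) (f := fun ω => (Z ω - S) ^ 2)
    (Eventually.of_forall fun ω => sq_nonneg _) hdevint (t ^ 2)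
  rw [le_div_iff₀ (by positivity), mul_comm]
  refine le_trans (le_of_eq ?_) (hmk.trans hvar)
  congr 2
  ext ω
  simp only [Set.mem_ofPred_eq]
  rw [← sq_abs (Z ω - S)]
  exact (pow_le_pow_iff_left₀ ht.le (abs_nonneg _) (by norm_num)).symm

/-- Markov's inequality for the number of events that occur. -/
theorem measureReal_count_ge_le {P : Measure Ω} [IsFiniteMeasure P] {E : ι → Set Ω}
    (hE : ∀ i, MeasurableSet (E i)) {t : ℝ} (ht : 0 < t) :
    P.real {ω | t ≤ ∑ i, (E i).indicator (fun _ => (1 : ℝ)) ω} ≤ (∑ i, P.real (E i)) / t := by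
  have hmk := mul_meas_ge_le_integral_of_nonneg (μ := P)
    (f := fun ω => ∑ i, (E i).indicator (fun _ => (1 : ℝ)) ω)
    (Eventually.of_forall fun ω => Finset.sum_nonneg fun i _ =>
      Set.indicator_nonneg (fun _ _ => zero_le_one) _)
    (integrable_finsetSum _ fun i _ => integrable_indicator_one (hE i)) t
  rw [integral_finsetSum _ fun i _ => integrable_indicator_one (hE i),
    Finset.sum_congr rfl fun i _ => integral_indicator_const_one (hE i)] at hmk
  rwa [le_div_iff₀ ht, mul_comm]

end Counting

/-! ### The law of the network -/

/-- The uniform law on the unit square. -/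
noncomputable def squareLaw : Measure Plane := (volume : Measure Plane).restrict unitSquare

/-- The law of the positions. -/
noncomputable def posLaw (n : ℕ) : Measure (Fin n → Plane) := Measure.pi fun _ => squareLaw

/-- The law of the destinations. -/
noncomputable def destLaw (n : ℕ) : Measure (Fin n → Fin n) :=
  uniformOn {d : Fin n → Fin n | ∀ i, d i ≠ i}

theorem law_eq (n : ℕ) : law n = (posLaw n).prod (destLaw n) := rfl

/-- An axis-parallel half-open box in the plane. -/
def box (a b : Fin 2 → ℝ) : Set Plane := {x | ∀ i, x i ∈ Set.Ico (a i) (b i)}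

theorem measurableSet_box (a b : Fin 2 → ℝ) : MeasurableSet (box a b) := by
  have : box a b = ⋂ i, (fun x : Plane => x i) ⁻¹' Set.Ico (a i) (b i) := by
    ext x; simp [box]
  rw [this]
  exact MeasurableSet.iInter fun i => (by fun_prop : Measurable fun x : Plane => x i)
    measurableSet_Ico

theorem measurableSet_unitSquare : MeasurableSet unitSquare := by
  have : unitSquare = ⋂ i, (fun x : Plane => x i) ⁻¹' Set.Icc (0 : ℝ) 1 := by
    ext x; simp [unitSquare]
  rw [this]
  exact MeasurableSet.iInter fun i => (by fun_prop : Measurable fun x : Plane => x i)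
    measurableSet_Icc

theorem volume_pi_plane (s : Fin 2 → Set ℝ) (hs : ∀ i, MeasurableSet (s i)) :
    (volume : Measure Plane) {x | ∀ i, x i ∈ s i} = volume (s 0) * volume (s 1) := by
  have h := (PiLp.volume_preserving_ofLp (Fin 2)).measure_preimage
    (MeasurableSet.univ_pi hs).nullMeasurableSet
  rw [volume_pi_pi, Fin.prod_univ_two] at h
  rw [← h]
  congr 1
  ext x
  simp

theorem squareLaw_box {a b : Fin 2 → ℝ} (ha : ∀ i, 0 ≤ a i) (hb : ∀ i, b i ≤ 1)
    (hab : ∀ i, a i ≤ b i) : squareLaw.real (box a b) = (b 0 - a 0) * (b 1 - a 1) := by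
  have hsub : box a b ⊆ unitSquare := fun x hx i =>
    ⟨(ha i).trans (hx i).1, (hx i).2.le.trans (hb i)⟩
  rw [Measure.real, squareLaw, Measure.restrict_apply (measurableSet_box a b),
    Set.inter_eq_left.2 hsub]
  have := volume_pi_plane (fun i => Set.Ico (a i) (b i)) fun i => measurableSet_Ico
  rw [box, this, Real.volume_Ico, Real.volume_Ico, ENNReal.toReal_mul,
    ENNReal.toReal_ofReal (sub_nonneg.2 (hab 0)), ENNReal.toReal_ofReal (sub_nonneg.2 (hab 1))]

instance : IsProbabilityMeasure squareLaw := ⟨by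
  rw [squareLaw, Measure.restrict_apply_univ]
  have := volume_pi_plane (fun _ => Set.Icc (0 : ℝ) 1) fun i => measurableSet_Icc
  rw [unitSquare, this]
  simp⟩

instance (n : ℕ) : IsProbabilityMeasure (posLaw n) := by
  unfold posLaw; infer_instance

/-- The maps without fixed points form a product set, so their uniform law is a product; this gives
independence of the destinations. -/
theorem destLaw_eq_pi (n : ℕ) : destLaw n = Measure.pi fun i => uniformOn ({i}ᶜ : Set (Fin n)) := by
  rw [← uniformOn_pi]
  unfold destLaw
  congr 1
  ext d
  simp

theorem isProbabilityMeasure_uniformOn_compl {n : ℕ} (hn : 2 ≤ n) (i : Fin n) :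
    IsProbabilityMeasure (uniformOn ({i}ᶜ : Set (Fin n))) := by
  refine isProbabilityMeasure_uniformOn (Set.toFinite _) ?_
  have : Nontrivial (Fin n) := Fin.nontrivial_iff_two_le.2 hn
  obtain ⟨j, hj⟩ := exists_ne i
  exact ⟨j, hj⟩

theorem isProbabilityMeasure_destLaw {n : ℕ} (hn : 2 ≤ n) : IsProbabilityMeasure (destLaw n) := by
  rw [destLaw_eq_pi]
  have := isProbabilityMeasure_uniformOn_compl hn
  infer_instance

theorem isProbabilityMeasure_law {n : ℕ} (hn : 2 ≤ n) : IsProbabilityMeasure (law n) := by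
  rw [law_eq]
  have := isProbabilityMeasure_destLaw hn
  infer_instance

theorem uniformOn_compl_real {n : ℕ} (hn : 2 ≤ n) (i : Fin n) (t : Finset (Fin n)) (hi : i ∉ t) :
    (uniformOn ({i}ᶜ : Set (Fin n))).real (t : Set (Fin n)) = t.card / (n - 1) := by
  have h : ({i}ᶜ : Set (Fin n)) = ((({i} : Finset (Fin n))ᶜ : Finset (Fin n)) : Set (Fin n)) := by
    simp
  have h2 : ({i}ᶜ : Finset (Fin n)) ∩ t = t :=
    Finset.inter_eq_right.2 fun j hj => by
      simp only [Finset.mem_compl, Finset.mem_singleton]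
      rintro rfl
      exact hi hj
  rw [Measure.real, h, uniformOn_apply_finset, h2, Finset.card_compl, Finset.card_singleton,
    Fintype.card_fin, ENNReal.toReal_div, ENNReal.toReal_natCast, ENNReal.toReal_natCast,
    Nat.cast_sub (by omega), Nat.cast_one]

theorem iIndepFun_dest (n : ℕ) (hn : 2 ≤ n) :
    iIndepFun (fun (i : Fin n) (d : Fin n → Fin n) => d i) (destLaw n) := by
  rw [destLaw_eq_pi]
  have := isProbabilityMeasure_uniformOn_compl hn
  exact iIndepFun_pi (X := fun _ x => x) fun i => aemeasurable_id

theorem destLaw_real_mem {n : ℕ} (hn : 2 ≤ n) (i : Fin n) (t : Finset (Fin n)) (hi : i ∉ t) :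
    (destLaw n).real {d | d i ∈ t} = t.card / (n - 1) := by
  rw [← uniformOn_compl_real hn i t hi, destLaw_eq_pi]
  have := isProbabilityMeasure_uniformOn_compl hn
  exact (measurePreserving_eval (fun i : Fin n => uniformOn ({i}ᶜ : Set (Fin n))) i).measureReal_preimage
    t.measurableSet.nullMeasurableSet

theorem destLaw_real_inter {n : ℕ} (hn : 2 ≤ n) {i k : Fin n} (hik : i ≠ k)
    (s t : Set (Fin n)) :
    (destLaw n).real ({d | d i ∈ s} ∩ {d | d k ∈ t}) =
      (destLaw n).real {d | d i ∈ s} * (destLaw n).real {d | d k ∈ t} := by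
  have h := ((iIndepFun_dest n hn).indepFun hik).measure_inter_preimage_eq_mul s t
    s.toFinite.measurableSet t.toFinite.measurableSet
  have h2 := congrArg ENNReal.toReal h
  rw [ENNReal.toReal_mul] at h2
  exact h2

theorem ae_dest_ne {n : ℕ} : ∀ᵐ d ∂(destLaw n), ∀ i, d i ≠ i := by
  unfold destLaw uniformOn
  exact ae_cond_mem (Set.toFinite _).measurableSet

theorem ae_law_dest_ne {n : ℕ} (hn : 2 ≤ n) : ∀ᵐ ω ∂(law n), ∀ i, ω.2 i ≠ i := by
  have := isProbabilityMeasure_destLaw hn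
  rw [law_eq]
  exact Measure.quasiMeasurePreserving_snd.ae ae_dest_ne

/-! ### Measurability -/

theorem measurableSet_adj {n : ℕ} (r : ℝ) (i j : Fin n) :
    MeasurableSet {X : Fin n → Plane | (hopGraph r X).Adj i j} := by
  have : {X : Fin n → Plane | (hopGraph r X).Adj i j} =
      {X | i ≠ j} ∩ {X | dist (X i) (X j) ≤ r} := rfl
  rw [this]
  exact (MeasurableSet.const _).inter (measurableSet_le (by fun_prop) measurable_const)

theorem measurableSet_hopGraph_eq {n : ℕ} (r : ℝ) (G : SimpleGraph (Fin n)) :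
    MeasurableSet {X : Fin n → Plane | hopGraph r X = G} := by
  have : {X : Fin n → Plane | hopGraph r X = G} =
      ⋂ i, ⋂ j, {X | (hopGraph r X).Adj i j ↔ G.Adj i j} := by
    ext X
    simp only [Set.mem_ofPred_eq, Set.mem_iInter, SimpleGraph.ext_iff, funext_iff, eq_iff_iff]
  rw [this]
  exact MeasurableSet.iInter fun i => MeasurableSet.iInter fun j =>
    (measurableSet_adj r i j).iff (MeasurableSet.const _)

/-- Every function of the hop graph and of the destinations is measurable. -/
theorem measurable_network {n : ℕ} {α : Type*} [MeasurableSpace α] (r : ℝ)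
    (F : SimpleGraph (Fin n) → (Fin n → Fin n) → α) :
    Measurable fun ω : Config n => F (hopGraph r ω.1) ω.2 := by
  -- There are finitely many graphs, so with the discrete σ-algebra every function of the graph and
  -- the destinations is measurable.
  let _ : MeasurableSpace (SimpleGraph (Fin n)) := ⊤
  have h1 : Measurable fun X : Fin n → Plane => hopGraph r X :=
    measurable_to_countable' fun G => measurableSet_hopGraph_eq r G
  have h2 : Measurable fun p : SimpleGraph (Fin n) × (Fin n → Fin n) => F p.1 p.2 :=
    measurable_of_countable _
  exact h2.comp ((h1.comp measurable_fst).prodMk measurable_snd)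

theorem measurableSet_isAdHoc {n : ℕ} (H : ℕ) (r : ℝ) (i : Fin n) :
    MeasurableSet {ω : Config n | IsAdHoc H r ω i} :=
  measurableSet_setOfPred.2
    (measurable_network r fun G d => ∃ p : G.Walk i (d i), p.length ≤ H)

theorem measurable_hops {n : ℕ} (r : ℝ) (i : Fin n) :
    Measurable fun ω : Config n => hops r ω i :=
  measurable_network r fun G d => G.dist i (d i)

/-! ### Pairs of close nodes -/

/-- The probability that two independent uniform points of the unit square are at distance at
most `R`. -/
noncomputable def nearProb (R : ℝ) : ℝ :=
  (squareLaw.prod squareLaw).real {q : Plane × Plane | dist q.1 q.2 ≤ R}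

theorem measurableSet_dist_le (R : ℝ) : MeasurableSet {q : Plane × Plane | dist q.1 q.2 ≤ R} :=
  measurableSet_le (by fun_prop) measurable_const

theorem nearProb_nonneg (R : ℝ) : 0 ≤ nearProb R := measureReal_nonneg

/-- With the first point fixed, the second must fall in a disc of area `π R²`; cutting it by the
square only decreases the measure. -/
theorem nearProb_le {R : ℝ} (hR : 0 ≤ R) : nearProb R ≤ Real.pi * R ^ 2 := by
  have h : (squareLaw.prod squareLaw) {q : Plane × Plane | dist q.1 q.2 ≤ R} ≤
      ENNReal.ofReal (Real.pi * R ^ 2) := by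
    rw [Measure.prod_apply (measurableSet_dist_le R)]
    calc ∫⁻ x, squareLaw (Prod.mk x ⁻¹' {q : Plane × Plane | dist q.1 q.2 ≤ R}) ∂squareLaw
        ≤ ∫⁻ _, ENNReal.ofReal (Real.pi * R ^ 2) ∂squareLaw := by
          refine lintegral_mono fun x => ?_
          have hx : Prod.mk x ⁻¹' {q : Plane × Plane | dist q.1 q.2 ≤ R} =
              Metric.closedBall x R := by
            ext y
            simp [dist_comm]
          rw [hx]
          refine (Measure.restrict_apply_le _ _).trans ?_
          rw [EuclideanSpace.volume_closedBall_fin_two, ← ENNReal.ofReal_pow hR, mul_comm,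
            ENNReal.ofReal_mul Real.pi_pos.le]
      _ = _ := by simp
  exact ENNReal.toReal_le_of_le_ofReal (by positivity) h

theorem iIndepFun_pos (n : ℕ) :
    iIndepFun (fun (i : Fin n) (X : Fin n → Plane) => X i) (posLaw n) :=
  iIndepFun_pi (X := fun _ x => x) fun _ => aemeasurable_id

theorem posLaw_map_eval {n : ℕ} (i : Fin n) :
    (posLaw n).map (fun X => X i) = squareLaw :=
  (measurePreserving_eval (fun _ : Fin n => squareLaw) i).map_eq

theorem posLaw_real_dist_le {n : ℕ} {i j : Fin n} (hij : i ≠ j) (R : ℝ) :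
    (posLaw n).real {X | dist (X i) (X j) ≤ R} = nearProb R := by
  have h := (indepFun_iff_map_prod_eq_prod_map_map (μ := posLaw n)
    (measurable_pi_apply i).aemeasurable (measurable_pi_apply j).aemeasurable).1 ((iIndepFun_pos n).indepFun hij)
  rw [posLaw_map_eval, posLaw_map_eval] at h
  rw [nearProb, ← h, measureReal_def, measureReal_def,
    Measure.map_apply (by fun_prop) (measurableSet_dist_le R)]
  rfl

theorem posLaw_real_dist_le_inter {n : ℕ} {i j k l : Fin n} (hij : i ≠ j) (hkl : k ≠ l)
    (hik : i ≠ k) (hil : i ≠ l) (hjk : j ≠ k) (hjl : j ≠ l) (R : ℝ) :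
    (posLaw n).real ({X | dist (X i) (X j) ≤ R} ∩ {X | dist (X k) (X l) ≤ R}) =
      nearProb R * nearProb R := by
  have h := ((iIndepFun_pos n).indepFun_prodMk_prodMk (fun i => by fun_prop) i j k l hik hil hjk
    hjl).measure_inter_preimage_eq_mul _ _ (measurableSet_dist_le R) (measurableSet_dist_le R)
  have h2 := congrArg ENNReal.toReal h
  rw [ENNReal.toReal_mul] at h2
  rw [← posLaw_real_dist_le hij R]
  nth_rewrite 2 [posLaw_real_dist_le hij R]
  rw [← posLaw_real_dist_le hkl R]
  exact h2

/-- Averaging over the destinations. -/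
theorem law_real_eq_integral {n : ℕ} (hn : 2 ≤ n) {S : Set (Config n)} (hS : MeasurableSet S) :
    (law n).real S = ∫ d, (posLaw n).real {X | (X, d) ∈ S} ∂(destLaw n) := by
  have := isProbabilityMeasure_destLaw hn
  rw [law_eq, measureReal_def, Measure.prod_apply_symm hS]
  exact (integral_toReal (measurable_of_countable _).aemeasurable
    (Eventually.of_forall fun d => measure_lt_top _ _)).symm

/-- The event that the destination of `i` is within distance `R`. -/
def nearEvent {n : ℕ} (R : ℝ) (i : Fin n) : Set (Config n) :=
  {ω | dist (ω.1 i) (ω.1 (ω.2 i)) ≤ R}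

theorem measurableSet_nearEvent {n : ℕ} (R : ℝ) (i : Fin n) :
    MeasurableSet (nearEvent R i) := by
  have : nearEvent R i = ⋃ j, {ω : Config n | dist (ω.1 i) (ω.1 j) ≤ R} ∩ {ω | ω.2 i = j} := by
    ext ω
    simp [nearEvent]
  rw [this]
  refine MeasurableSet.iUnion fun j => MeasurableSet.inter ?_ ?_
  · exact measurableSet_le (by fun_prop) measurable_const
  · exact (by fun_prop : Measurable fun ω : Config n => ω.2 i) (measurableSet_singleton j)

theorem law_real_nearEvent {n : ℕ} (hn : 2 ≤ n) (R : ℝ) (i : Fin n) :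
    (law n).real (nearEvent R i) = nearProb R := by
  have := isProbabilityMeasure_destLaw hn
  rw [law_real_eq_integral hn (measurableSet_nearEvent R i)]
  rw [integral_congr_ae (g := fun _ => nearProb R)]
  · simp
  · filter_upwards [ae_dest_ne] with d hd
    exact posLaw_real_dist_le (hd i).symm R

/-! ### Weak dependence of two trips -/

theorem destLaw_real_eq_le {n : ℕ} (hn : 2 ≤ n) (i j : Fin n) :
    (destLaw n).real {d | d i = j} ≤ 1 / (n - 1) := by
  have hn' : (2 : ℝ) ≤ n := by exact_mod_cast hn
  by_cases hij : i = j
  · have : (destLaw n).real {d | d i = j} = 0 := by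
      rw [measureReal_def, measure_eq_zero_iff_ae_notMem.2]
      · simp
      · filter_upwards [ae_dest_ne] with d hd h
        exact hd i (h.trans hij.symm)
    rw [this]
    exact div_nonneg zero_le_one (by linarith)
  · have := destLaw_real_mem hn i {j} (by simpa using hij)
    simp only [Finset.mem_singleton, Finset.card_singleton, Nat.cast_one] at this
    exact this.le

/-- The trips of `i` and `k` have an end in common. -/
def Overlap {n : ℕ} (i k : Fin n) : Set (Fin n → Fin n) := {d | d k = i ∨ d i = k ∨ d i = d k}

/-- Three coincidences, each of probability at most `1 / (n - 1)`. -/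
theorem destLaw_real_overlap_le {n : ℕ} (hn : 2 ≤ n) {i k : Fin n} (hik : i ≠ k) :
    (destLaw n).real (Overlap i k) ≤ 3 / (n - 1) := by
  have := isProbabilityMeasure_destLaw hn
  have hn' : (2 : ℝ) ≤ n := by exact_mod_cast hn
  have h3 : (destLaw n).real {d | d i = d k} ≤ 1 / (n - 1) := by
    have hU : {d : Fin n → Fin n | d i = d k} = ⋃ j, {d | d i ∈ ({j} : Set _)} ∩ {d | d k ∈ ({j} : Set _)} := by
      ext d
      simp [eq_comm]
    calc (destLaw n).real {d | d i = d k}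
        ≤ ∑ j, (destLaw n).real ({d | d i ∈ ({j} : Set _)} ∩ {d | d k ∈ ({j} : Set _)}) := by
          rw [hU]; exact measureReal_iUnion_fintype_le _
      _ ≤ ∑ j, (destLaw n).real {d | d i = j} * (1 / (n - 1)) := by
          refine Finset.sum_le_sum fun j _ => ?_
          rw [destLaw_real_inter hn hik]
          exact mul_le_mul_of_nonneg_left (destLaw_real_eq_le hn k j) measureReal_nonneg
      _ = 1 / (n - 1) := by
          rw [← Finset.sum_mul]
          have : ∑ j, (destLaw n).real ((fun d : Fin n → Fin n => d i) ⁻¹' {j}) =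
              (destLaw n).real ((fun d : Fin n → Fin n => d i) ⁻¹' ↑(Finset.univ : Finset (Fin n))) :=
            sum_measureReal_preimage_singleton _ fun j _ => (Set.toFinite _).measurableSet
          simp only [Finset.coe_univ, Set.preimage_univ, probReal_univ] at this
          have h' : ∑ j, (destLaw n).real {d | d i = j} = 1 := this
          rw [h', one_mul]
  have hU : Overlap i k = {d | d k = i} ∪ ({d | d i = k} ∪ {d | d i = d k}) := rfl
  have h1 := destLaw_real_eq_le hn k i
  have h2 := destLaw_real_eq_le hn i k
  have h4 : (3 : ℝ) / (n - 1) = 1 / (n - 1) + (1 / (n - 1) + 1 / (n - 1)) := by ring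
  rw [hU, h4]
  exact (measureReal_union_le _ _).trans (add_le_add h1
    ((measureReal_union_le _ _).trans (add_le_add h2 h3)))

/-- Condition on the destinations. Without overlap the four ends are distinct nodes and the
probability factors; with overlap one of the two events is dropped. -/
theorem law_real_nearEvent_inter_le {n : ℕ} (hn : 2 ≤ n) (R : ℝ) {i k : Fin n} (hik : i ≠ k) :
    (law n).real (nearEvent R i ∩ nearEvent R k) ≤
      nearProb R ^ 2 + nearProb R * (3 / (n - 1)) := by
  have := isProbabilityMeasure_destLaw hn
  have hO : MeasurableSet (Overlap i k) := (Set.toFinite _).measurableSet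
  rw [law_real_eq_integral hn ((measurableSet_nearEvent R i).inter (measurableSet_nearEvent R k))]
  calc _ ≤ ∫ d, (nearProb R ^ 2 + nearProb R * (Overlap i k).indicator (fun _ => (1 : ℝ)) d)
          ∂(destLaw n) := by
        refine integral_mono_ae .of_finite .of_finite ?_
        filter_upwards [ae_dest_ne] with d hd
        by_cases h : d ∈ Overlap i k
        · rw [Set.indicator_of_mem h, mul_one]
          refine le_trans (measureReal_mono ?_) (le_trans
            (posLaw_real_dist_le (hd i).symm R).le ?_)
          · exact fun X hX => hX.1
          · linarith [sq_nonneg (nearProb R)]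
        · rw [Set.indicator_of_notMem h, mul_zero, add_zero, sq]
          simp only [Overlap, Set.mem_ofPred_eq, not_or] at h
          exact (posLaw_real_dist_le_inter (hd i).symm (hd k).symm hik (fun h' => h.1 h'.symm) h.2.1
            h.2.2 R).le
    _ = nearProb R ^ 2 + nearProb R * (destLaw n).real (Overlap i k) := by
        rw [integral_add (integrable_const _) .of_finite, integral_const_mul,
          integral_indicator_const_one hO]
        simp
    _ ≤ _ := by
        gcongr
        · exact nearProb_nonneg R
        · exact destLaw_real_overlap_le hn hik

/-- With few exceptions, at most `a + t` destinations are within distance `R` of their sources. -/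
theorem law_real_count_near_ge_le {n : ℕ} (hn : 2 ≤ n) {R a t : ℝ} (hR : 0 ≤ R)
    (ha : n * (Real.pi * R ^ 2) ≤ a) (ht : 0 < t) :
    (law n).real {ω | a + t ≤ ∑ i, (nearEvent R i).indicator (fun _ => (1 : ℝ)) ω} ≤
      7 * a / t ^ 2 := by
  have := isProbabilityMeasure_law hn
  have hn' : (2 : ℝ) ≤ n := by exact_mod_cast hn
  have hp0 := nearProb_nonneg R
  have hp : n * nearProb R ≤ a :=
    le_trans (mul_le_mul_of_nonneg_left (nearProb_le hR) (by linarith)) ha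
  have hS : ∑ i : Fin n, (law n).real (nearEvent R i) = n * nearProb R := by
    simp [law_real_nearEvent hn]
  have hV : ∑ i : Fin n, ∑ k : Fin n, (law n).real (nearEvent R i ∩ nearEvent R k) ≤
      (∑ i : Fin n, (law n).real (nearEvent R i)) ^ 2 + 7 * (n * nearProb R) := by
    rw [hS]
    have hb : ∀ i k : Fin n, (law n).real (nearEvent R i ∩ nearEvent R k) ≤
        (if i = k then nearProb R else 0) + (nearProb R ^ 2 + nearProb R * (3 / (n - 1))) := by
      intro i k
      split_ifs with h
      · subst h
        rw [Set.inter_self, law_real_nearEvent hn]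
        have : 0 ≤ nearProb R * (3 / ((n : ℝ) - 1)) :=
          mul_nonneg hp0 (div_nonneg (by norm_num) (by linarith))
        linarith [sq_nonneg (nearProb R)]
      · rw [zero_add]
        exact law_real_nearEvent_inter_le hn R h
    refine (Finset.sum_le_sum fun i _ => Finset.sum_le_sum fun k _ => hb i k).trans ?_
    simp only [Finset.sum_add_distrib, Finset.sum_ite_eq, Finset.mem_univ, if_true,
      Finset.sum_const, Finset.card_univ, Fintype.card_fin, nsmul_eq_mul]
    -- The overlaps add at most 6 times the mean to the second moment and the diagonal terms at most
    -- once the mean: together the factor 7.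
    have h6 : (n : ℝ) * (3 / (n - 1)) ≤ 6 := by
      rw [mul_div_assoc', div_le_iff₀ (by linarith)]
      linarith
    have : (n : ℝ) * (n * (nearProb R * (3 / (n - 1)))) ≤ n * (nearProb R * 6) := by
      rw [show (n : ℝ) * (nearProb R * (3 / (n - 1))) = nearProb R * (n * (3 / (n - 1))) by ring]
      gcongr
    nlinarith
  refine le_trans (measureReal_mono ?_) ((measureReal_abs_count_sub_ge
    (measurableSet_nearEvent R) ht hV).trans ?_)
  · intro ω hω
    simp only [Set.mem_ofPred_eq, hS] at hω ⊢
    refine le_trans ?_ (le_abs_self _)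
    linarith
  · gcongr

/-! ### The number of sources in the ad hoc mode, given the positions -/

/-- `j` is within `H` hops of `i`. -/
def Within {n : ℕ} (H : ℕ) (r : ℝ) (X : Fin n → Plane) (i j : Fin n) : Prop :=
  ∃ p : (hopGraph r X).Walk i j, p.length ≤ H

open Classical in
/-- The other nodes within `H` hops of `i`. -/
noncomputable def reach {n : ℕ} (H : ℕ) (r : ℝ) (X : Fin n → Plane) (i : Fin n) :
    Finset (Fin n) :=
  Finset.univ.filter fun j => j ≠ i ∧ Within H r X i j

theorem measurable_graph {n : ℕ} {α : Type*} [MeasurableSpace α] (r : ℝ)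
    (F : SimpleGraph (Fin n) → α) : Measurable fun X : Fin n → Plane => F (hopGraph r X) := by
  let _ : MeasurableSpace (SimpleGraph (Fin n)) := ⊤
  have h1 : Measurable fun X : Fin n → Plane => hopGraph r X :=
    measurable_to_countable' fun G => measurableSet_hopGraph_eq r G
  have h2 : Measurable F := measurable_of_countable _
  exact h2.comp h1

/-- The number of ordered pairs of nodes within `H` hops. -/
noncomputable def reachCount {n : ℕ} (H : ℕ) (r : ℝ) (X : Fin n → Plane) : ℕ :=
  ∑ i, (reach H r X i).card

open Classical in
theorem measurable_reachCount {n : ℕ} (H : ℕ) (r : ℝ) :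
    Measurable fun X : Fin n → Plane => reachCount H r X :=
  measurable_graph r fun G =>
    ∑ i, (Finset.univ.filter fun j => j ≠ i ∧ ∃ p : G.Walk i j, p.length ≤ H).card

theorem card_adHocSources {n : ℕ} (P : Params) (ω : Config n) :
    ((adHocSources P ω).card : ℝ) =
      ∑ i, {ω | IsAdHoc P.H P.r ω i}.indicator (fun _ => (1 : ℝ)) ω := by
  unfold adHocSources
  rw [Finset.card_filter]
  push_cast
  refine Finset.sum_congr rfl fun i _ => ?_
  by_cases h : IsAdHoc P.H P.r ω i <;> simp [h]

theorem measurable_card_adHocSources {n : ℕ} (P : Params) :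
    Measurable fun ω : Config n => ((adHocSources P ω).card : ℝ) := by
  simp only [card_adHocSources]
  exact Finset.measurable_fun_sum _ fun i _ =>
    measurable_const.indicator (measurableSet_isAdHoc P.H P.r i)

/-- For independent events the variance is at most the mean `S`, so a deviation of `S / 2` has
probability at most `4 / S`, and `S ≥ l`. -/
theorem destLaw_real_count_le {n : ℕ} (hn : 2 ≤ n) (N : Fin n → Finset (Fin n))
    (hN : ∀ i, i ∉ N i) {l : ℝ} (hl : 0 < l) (hle : l * n ≤ ∑ i, ((N i).card : ℝ)) :
    (destLaw n).real {d | ∑ i, {d : Fin n → Fin n | d i ∈ N i}.indicator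
      (fun _ => (1 : ℝ)) d ≤ l / 2} ≤ 4 / l := by
  have := isProbabilityMeasure_destLaw hn
  have hn' : (2 : ℝ) ≤ n := by exact_mod_cast hn
  have hP : ∀ i, (destLaw n).real {d | d i ∈ N i} = (N i).card / (n - 1) := fun i =>
    destLaw_real_mem hn i _ (hN i)
  set S := ∑ i, (destLaw n).real {d | d i ∈ N i} with hS
  have hlS : l ≤ S := by
    rw [hS]
    simp only [hP, ← Finset.sum_div]
    rw [le_div_iff₀ (by linarith)]
    linarith
  have hS0 : 0 < S := hl.trans_le hlS
  have hV : ∑ i, ∑ k, (destLaw n).real ({d | d i ∈ N i} ∩ {d | d k ∈ N k}) ≤ S ^ 2 + S := by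
    have hb : ∀ i k : Fin n, (destLaw n).real ({d | d i ∈ N i} ∩ {d | d k ∈ N k}) ≤
        (destLaw n).real {d | d i ∈ N i} * (destLaw n).real {d | d k ∈ N k} +
        (if i = k then (destLaw n).real {d | d i ∈ N i} else 0) := by
      intro i k
      split_ifs with h
      · subst h
        rw [Set.inter_self]
        have : 0 ≤ (destLaw n).real {d | d i ∈ N i} := measureReal_nonneg
        nlinarith
      · rw [add_zero]
        exact (destLaw_real_inter hn h (N i : Set (Fin n)) (N k : Set (Fin n))).le
    refine (Finset.sum_le_sum fun i _ => Finset.sum_le_sum fun k _ => hb i k).trans ?_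
    simp only [Finset.sum_add_distrib, Finset.sum_ite_eq, Finset.mem_univ, if_true]
    rw [sq, hS, Finset.sum_mul_sum]
  refine (measureReal_mono ?_).trans ((measureReal_abs_count_sub_ge
    (fun i => (Set.toFinite _).measurableSet) (half_pos hS0) hV).trans ?_)
  · intro d hd
    simp only [Set.mem_ofPred_eq] at hd ⊢
    refine le_trans ?_ (neg_le_abs _)
    linarith
  · rw [div_le_div_iff₀ (by positivity) hl]
    nlinarith

/-- Fubini separates the two sources of randomness: either the positions offer too few reachable
pairs, or the independent destinations hit the sets `reach` unusually rarely. -/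
theorem law_real_card_adHocSources_le {n : ℕ} (hn : 2 ≤ n) (P : Params) {l : ℝ} (hl : 0 < l) :
    (law n).real {ω | ((adHocSources P ω).card : ℝ) ≤ l / 2} ≤
      (posLaw n).real {X | (reachCount P.H P.r X : ℝ) < l * n} + 4 / l := by
  have := isProbabilityMeasure_destLaw hn
  set S : Set (Config n) := {ω | ((adHocSources P ω).card : ℝ) ≤ l / 2}
  set B : Set (Fin n → Plane) := {X | (reachCount P.H P.r X : ℝ) < l * n}
  have hB : MeasurableSet B := measurableSet_lt
    (measurable_from_nat.comp (measurable_reachCount P.H P.r)) measurable_const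
  have hS : MeasurableSet S := measurableSet_le (measurable_card_adHocSources P) measurable_const
  have hint : (law n).real S = ∫ X, (destLaw n).real (Prod.mk X ⁻¹' S) ∂(posLaw n) := by
    rw [law_eq, measureReal_def, Measure.prod_apply hS]
    exact (integral_toReal (measurable_measure_prodMk_left hS).aemeasurable
      (Eventually.of_forall fun d => measure_lt_top _ _)).symm
  rw [hint]
  calc _ ≤ ∫ X, (B.indicator (fun _ => (1 : ℝ)) X + 4 / l) ∂(posLaw n) := by
        refine integral_mono_of_nonneg (Eventually.of_forall fun X => measureReal_nonneg)
          ((integrable_indicator_one hB).add (integrable_const _))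
          (Eventually.of_forall fun X => ?_)
        by_cases hX : X ∈ B
        · simp only [Set.indicator_of_mem hX]
          have : 0 < 4 / l := by positivity
          linarith [measureReal_le_one (μ := destLaw n) (s := Prod.mk X ⁻¹' S)]
        · simp only [Set.indicator_of_notMem hX, zero_add]
          simp only [B, Set.mem_ofPred_eq, not_lt, reachCount, Nat.cast_sum] at hX
          refine le_trans (measureReal_mono ?_) (destLaw_real_count_le hn (reach P.H P.r X)
            (fun i => by simp [reach]) hl hX)
          intro d hd
          simp only [S, Set.mem_preimage, Set.mem_ofPred_eq, card_adHocSources] at hd ⊢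
          refine le_trans (Finset.sum_le_sum fun i _ => ?_) hd
          by_cases h : d i ∈ reach P.H P.r X i
          · have h2 : IsAdHoc P.H P.r (X, d) i := by
              simp only [reach, Finset.mem_filter] at h
              exact h.2.2
            simp [h, h2]
          · have h2 : d ∉ {d : Fin n → Fin n | d i ∈ reach P.H P.r X i} := h
            rw [Set.indicator_of_notMem h2]
            exact Set.indicator_nonneg (fun _ _ => zero_le_one) _
    _ = _ := by
        rw [integral_add (integrable_indicator_one hB) (integrable_const _),
          integral_indicator_const_one hB]
        simp

/-! ### Paths through occupied cells -/

section Within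

variable {n : ℕ} {r : ℝ} {X : Fin n → Plane} {i j k : Fin n} {a b : ℕ}

theorem Within.mono (h : Within a r X i j) (hab : a ≤ b) : Within b r X i j :=
  h.imp fun _ hp => hp.trans hab

theorem Within.symm (h : Within a r X i j) : Within a r X j i :=
  h.elim fun p hp => ⟨p.reverse, by rwa [SimpleGraph.Walk.length_reverse]⟩

theorem Within.trans (h : Within a r X i j) (h' : Within b r X j k) :
    Within (a + b) r X i k := by
  obtain ⟨p, hp⟩ := h
  obtain ⟨q, hq⟩ := h'
  exact ⟨p.append q, by rw [SimpleGraph.Walk.length_append]; omega⟩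

theorem within_one_of_dist_le (h : dist (X i) (X j) ≤ r) : Within 1 r X i j := by
  by_cases hij : i = j
  · subst hij
    exact ⟨SimpleGraph.Walk.nil, by simp⟩
  · have hadj : (hopGraph r X).Adj i j := ⟨hij, h⟩
    exact ⟨hadj.toWalk, by simp⟩

end Within

/-- The index of the cell of side `1 / M` that contains `x`. -/
noncomputable def cell (M : ℕ) (x : Plane) : ℕ × ℕ := (⌊M * x 0⌋₊, ⌊M * x 1⌋₊)

/-- Two cells coincide or touch. -/
def Touch (c d : ℕ × ℕ) : Prop := c.1 ≤ d.1 + 1 ∧ d.1 ≤ c.1 + 1 ∧ c.2 ≤ d.2 + 1 ∧ d.2 ≤ c.2 + 1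

theorem abs_sub_le_of_floor {M x y : ℝ} (hM : 0 < M) (hx : 0 ≤ x) (hy : 0 ≤ y)
    (h1 : ⌊M * x⌋₊ ≤ ⌊M * y⌋₊ + 1) (h2 : ⌊M * y⌋₊ ≤ ⌊M * x⌋₊ + 1) : |x - y| ≤ 2 / M := by
  have hx1 := Nat.floor_le (mul_nonneg hM.le hx)
  have hx2 := Nat.lt_floor_add_one (M * x)
  have hy1 := Nat.floor_le (mul_nonneg hM.le hy)
  have hy2 := Nat.lt_floor_add_one (M * y)
  have h1' : (⌊M * x⌋₊ : ℝ) ≤ ⌊M * y⌋₊ + 1 := by exact_mod_cast h1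
  have h2' : (⌊M * y⌋₊ : ℝ) ≤ ⌊M * x⌋₊ + 1 := by exact_mod_cast h2
  rw [abs_le, le_div_iff₀ hM, neg_le, le_div_iff₀ hM]
  constructor <;> nlinarith

theorem dist_le_of_touch {M : ℕ} (hM : 0 < M) {x y : Plane} (hx : ∀ i, 0 ≤ x i)
    (hy : ∀ i, 0 ≤ y i) (h : Touch (cell M x) (cell M y)) : dist x y ≤ 3 / M := by
  have hM' : (0 : ℝ) < M := by exact_mod_cast hM
  have h0 := abs_sub_le_of_floor hM' (hx 0) (hy 0) h.1 h.2.1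
  have h1 := abs_sub_le_of_floor hM' (hx 1) (hy 1) h.2.2.1 h.2.2.2
  rw [EuclideanSpace.dist_eq, Fin.sum_univ_two, Real.dist_eq, Real.dist_eq]
  refine Real.sqrt_le_iff.2 ⟨by positivity, ?_⟩
  -- Each coordinate differs by at most `2 / M`, and `4 + 4 ≤ 9`.
  have h2 : (3 / M : ℝ) ^ 2 = 9 / 4 * (2 / M) ^ 2 := by ring
  rw [h2]
  have := pow_le_pow_left₀ (abs_nonneg _) h0 2
  have := pow_le_pow_left₀ (abs_nonneg _) h1 2
  nlinarith [sq_nonneg (2 / M : ℝ)]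

/-! ### Hop paths along chains of occupied cells -/

section Occupied

variable {n : ℕ} {r : ℝ} {X : Fin n → Plane} {M : ℕ}

/-- Some node lies in the cell `c`. -/
def Occ (M : ℕ) (X : Fin n → Plane) (c : ℕ × ℕ) : Prop := ∃ i, cell M (X i) = c

/-- Nodes in touching cells are one hop apart. -/
def TouchHop (M : ℕ) (r : ℝ) (X : Fin n → Plane) : Prop :=
  ∀ i j, Touch (cell M (X i)) (cell M (X j)) → Within 1 r X i j

theorem touchHop_of_le (hM : 0 < M) (hr : 3 ≤ M * r) (hX : ∀ i k, 0 ≤ X i k) :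
    TouchHop M r X := by
  intro i j h
  have hM' : (0 : ℝ) < M := by exact_mod_cast hM
  refine within_one_of_dist_le ((dist_le_of_touch hM (hX i) (hX j) h).trans ?_)
  rw [div_le_iff₀ hM']
  linarith

/-- Pick one node in every cell of the chain. The extra hop is needed at `t = 0`, where the ends may
be different nodes of one cell. -/
theorem within_of_path (hT : TouchHop M r X) (f : ℕ → ℕ × ℕ) (t : ℕ)
    (hocc : ∀ k ≤ t, Occ M X (f k)) (hf : ∀ k, Touch (f k) (f (k + 1))) {i j : Fin n}
    (hi : cell M (X i) = f 0) (hj : cell M (X j) = f t) : Within (t + 1) r X i j := by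
  induction t generalizing j with
  | zero =>
    refine hT i j ?_
    rw [hi, hj]
    simp [Touch]
  | succ t ih =>
    obtain ⟨k, hk⟩ := hocc t (by omega)
    refine (ih (fun k hk => hocc k (by omega)) hk).trans (hT k j ?_)
    rw [hk, hj]
    exact hf t

/-- Nodes in an occupied line segment of `T` cells are at most `T` hops apart. -/
theorem within_of_segment (hT : TouchHop M r X) (g : ℕ → ℕ × ℕ)
    (hg : ∀ k, Touch (g k) (g (k + 1))) {a T u u' : ℕ}
    (hocc : ∀ k ∈ Finset.Ico a (a + T), Occ M X (g k)) (hu : u ∈ Finset.Ico a (a + T))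
    (hu' : u' ∈ Finset.Ico a (a + T)) {i j : Fin n} (hi : cell M (X i) = g u)
    (hj : cell M (X j) = g u') : Within T r X i j := by
  wlog h : u ≤ u' generalizing u u' i j
  · exact (this hu' hu hj hi (by omega)).symm
  rw [Finset.mem_Ico] at hu hu'
  refine (within_of_path hT (fun k => g (u + k)) (u' - u) (fun k hk => hocc _ ?_)
    (fun k => hg (u + k)) hi ?_).mono (by omega)
  · rw [Finset.mem_Ico]; omega
  · rw [hj]
    congr 1
    omega

/-! ### Blocks of cells -/

/-- The interval of cell coordinates of the block coordinate `a`. -/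
def span (L a : ℕ) : Finset ℕ := Finset.Ico (a * L) (a * L + L)

open Classical in
/-- The empty cells of a block of `L * L` cells. -/
noncomputable def emptyCells (M L : ℕ) (X : Fin n → Plane) (a b : ℕ) : Finset (ℕ × ℕ) :=
  (span L a ×ˢ span L b).filter fun c => ¬ Occ M X c

/-- All cells of the row `v` of a block are occupied. -/
def FullRow (M L : ℕ) (X : Fin n → Plane) (a v : ℕ) : Prop := ∀ u ∈ span L a, Occ M X (u, v)

/-- All cells of the column `u` of a block are occupied. -/
def FullCol (M L : ℕ) (X : Fin n → Plane) (b u : ℕ) : Prop := ∀ v ∈ span L b, Occ M X (u, v)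

/-- Pigeonhole: fewer than `L` cells cannot meet all `L` rows. -/
theorem exists_row_avoiding {L : ℕ} (b : ℕ) {E : Finset (ℕ × ℕ)} (hE : E.card < L) :
    ∃ v ∈ span L b, ∀ c ∈ E, c.2 ≠ v := by
  obtain ⟨v, hv, hv'⟩ := Finset.exists_mem_notMem_of_card_lt_card (s := E.image Prod.snd)
    (t := span L b) (lt_of_le_of_lt Finset.card_image_le (by simpa [span] using hE))
  exact ⟨v, hv, fun c hc h => hv' (Finset.mem_image.2 ⟨c, hc, h⟩)⟩

theorem exists_col_avoiding {L : ℕ} (a : ℕ) {E : Finset (ℕ × ℕ)} (hE : E.card < L) :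
    ∃ u ∈ span L a, ∀ c ∈ E, c.1 ≠ u := by
  obtain ⟨v, hv, hv'⟩ := Finset.exists_mem_notMem_of_card_lt_card (s := E.image Prod.fst)
    (t := span L a) (lt_of_le_of_lt Finset.card_image_le (by simpa [span] using hE))
  exact ⟨v, hv, fun c hc h => hv' (Finset.mem_image.2 ⟨c, hc, h⟩)⟩

/-- The block has few empty cells. -/
def FewEmpty (M L : ℕ) (X : Fin n → Plane) (a b : ℕ) : Prop :=
  2 * (emptyCells M L X a b).card < L

variable {L a b : ℕ}

/-- The factor 2 in `FewEmpty` leaves fewer than `L` empty cells in the two blocks together, so some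
row avoids all of them. -/
theorem exists_common_fullRow {a' : ℕ} (h : FewEmpty M L X a b) (h' : FewEmpty M L X a' b) :
    ∃ v ∈ span L b, FullRow M L X a v ∧ FullRow M L X a' v := by
  classical
  obtain ⟨v, hv, hE⟩ := exists_row_avoiding (L := L) b (E := emptyCells M L X a b ∪ emptyCells M L X a' b)
    (lt_of_le_of_lt (Finset.card_union_le _ _) (by unfold FewEmpty at h h'; omega))
  refine ⟨v, hv, fun u hu => ?_, fun u hu => ?_⟩ <;> by_contra hc <;>
    refine hE (u, v) ?_ rfl <;> simp [emptyCells, hu, hv, hc]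

theorem exists_common_fullCol {b' : ℕ} (h : FewEmpty M L X a b) (h' : FewEmpty M L X a b') :
    ∃ u ∈ span L a, FullCol M L X b u ∧ FullCol M L X b' u := by
  classical
  obtain ⟨v, hv, hE⟩ := exists_col_avoiding (L := L) a (E := emptyCells M L X a b ∪ emptyCells M L X a b')
    (lt_of_le_of_lt (Finset.card_union_le _ _) (by unfold FewEmpty at h h'; omega))
  refine ⟨v, hv, fun u hu => ?_, fun u hu => ?_⟩ <;> by_contra hc <;>
    refine hE (v, u) ?_ rfl <;> simp [emptyCells, hu, hv, hc]

/-- The node `i` lies in an occupied row of the block `(a, b)`. -/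
structure Bone (M L : ℕ) (X : Fin n → Plane) (a b : ℕ) (i : Fin n) : Prop where
  fst_mem : (cell M (X i)).1 ∈ span L a
  snd_mem : (cell M (X i)).2 ∈ span L b
  full : FullRow M L X a (cell M (X i)).2

theorem within_of_row (hT : TouchHop M r X) {v : ℕ} (hv : FullRow M L X a v) {i j : Fin n}
    {u u' : ℕ} (hu : u ∈ span L a) (hu' : u' ∈ span L a) (hi : cell M (X i) = (u, v))
    (hj : cell M (X j) = (u', v)) : Within L r X i j :=
  within_of_segment hT (fun k => (k, v)) (fun k => by simp only [Touch]; omega) hv hu hu' hi hj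

theorem within_of_col (hT : TouchHop M r X) {u : ℕ} (hu : FullCol M L X b u) {i j : Fin n}
    {v v' : ℕ} (hv : v ∈ span L b) (hv' : v' ∈ span L b) (hi : cell M (X i) = (u, v))
    (hj : cell M (X j) = (u, v')) : Within L r X i j :=
  within_of_segment hT (fun k => (u, k)) (fun k => by simp only [Touch]; omega) hu hv hv' hi hj

theorem within_of_adjacent_cols (hT : TouchHop M r X) {u : ℕ} (hu : FullCol M L X b u)
    (hu' : FullCol M L X (b + 1) u) {i j : Fin n} {v v' : ℕ} (hv : v ∈ span L b)
    (hv' : v' ∈ span L (b + 1)) (hi : cell M (X i) = (u, v)) (hj : cell M (X j) = (u, v')) :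
    Within (2 * L) r X i j := by
  simp only [span, Finset.mem_Ico, add_mul, one_mul] at hv hv'
  refine within_of_segment hT (fun k => (u, k)) (fun k => by simp only [Touch]; omega) (a := b * L)
    (u := v) (u' := v') (fun k hk => ?_) ?_ ?_ hi hj
  · rw [Finset.mem_Ico] at hk
    by_cases hkL : k < b * L + L
    · exact hu k (by simp only [span, Finset.mem_Ico]; omega)
    · exact hu' k (by simp only [span, Finset.mem_Ico, add_mul, one_mul]; omega)
  · rw [Finset.mem_Ico]; omega
  · rw [Finset.mem_Ico]; omega

theorem exists_bone (h : FewEmpty M L X a b) : ∃ i, Bone M L X a b i := by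
  obtain ⟨v, hv, hrow, -⟩ := exists_common_fullRow h h
  have hL : 0 < L := by unfold FewEmpty at h; omega
  have ha : a * L ∈ span L a := by simp [span, hL]
  obtain ⟨i, hi⟩ := hrow (a * L) ha
  exact ⟨i, by rw [hi]; exact ha, by rw [hi]; exact hv, by rw [hi]; exact hrow⟩

/-- Every full column crosses every full row: go along the first row, along the column, along the
second row. -/
theorem Bone.within (hT : TouchHop M r X) (h : FewEmpty M L X a b) {i j : Fin n}
    (hi : Bone M L X a b i) (hj : Bone M L X a b j) : Within (3 * L) r X i j := by
  obtain ⟨u, hu, hcol, -⟩ := exists_common_fullCol h h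
  obtain ⟨p, hp⟩ := hi.full u hu
  obtain ⟨q, hq⟩ := hj.full u hu
  refine (((within_of_row hT hi.full hi.fst_mem hu rfl hp).trans
    (within_of_col hT hcol hi.snd_mem hj.snd_mem hp hq)).trans
    (within_of_row hT hj.full hu hj.fst_mem hq rfl)).mono (by omega)

/-- A row that is full in both blocks crosses their common side in one hop; reaching it and leaving
it costs `3 * L` each, and `6 * L + 1 ≤ 7 * L`. -/
theorem Bone.within_right (hT : TouchHop M r X) (h : FewEmpty M L X a b)
    (h' : FewEmpty M L X (a + 1) b) {i j : Fin n} (hi : Bone M L X a b i)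
    (hj : Bone M L X (a + 1) b j) : Within (7 * L) r X i j := by
  obtain ⟨v, hv, hrow, hrow'⟩ := exists_common_fullRow h h'
  have hL : 0 < L := by unfold FewEmpty at h; omega
  have h1 : a * L + (L - 1) ∈ span L a := by simp only [span, Finset.mem_Ico]; omega
  have h2 : a * L + L ∈ span L (a + 1) := by
    simp only [span, Finset.mem_Ico, add_mul, one_mul]; omega
  obtain ⟨p, hp⟩ := hrow _ h1
  obtain ⟨q, hq⟩ := hrow' _ h2
  have hpB : Bone M L X a b p := ⟨by rw [hp]; exact h1, by rw [hp]; exact hv, by rw [hp]; exact hrow⟩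
  have hqB : Bone M L X (a + 1) b q :=
    ⟨by rw [hq]; exact h2, by rw [hq]; exact hv, by rw [hq]; exact hrow'⟩
  have hpq : Within 1 r X p q := hT p q (by rw [hp, hq]; simp only [Touch]; omega)
  exact (((hi.within hT h hpB).trans hpq).trans (hqB.within hT h' hj)).mono (by omega)

/-- A column full in both blocks meets the two given rows directly. This takes only `4 * L` hops;
the bound is matched to the horizontal case. -/
theorem Bone.within_up (hT : TouchHop M r X) (h : FewEmpty M L X a b)
    (h' : FewEmpty M L X a (b + 1)) {i j : Fin n} (hi : Bone M L X a b i)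
    (hj : Bone M L X a (b + 1) j) : Within (7 * L) r X i j := by
  obtain ⟨u, hu, hcol, hcol'⟩ := exists_common_fullCol h h'
  obtain ⟨p, hp⟩ := hi.full u hu
  obtain ⟨q, hq⟩ := hj.full u hu
  refine (((within_of_row hT hi.full hi.fst_mem hu rfl hp).trans
    (within_of_adjacent_cols hT hcol hcol' hi.snd_mem hj.snd_mem hp hq)).trans
    (within_of_row hT hj.full hu hj.fst_mem hq rfl)).mono (by omega)

variable {B : ℕ}

theorem Bone.within_horizontal (hT : TouchHop M r X)
    (h : ∀ a < B, ∀ b < B, FewEmpty M L X a b) (hb : b < B) (t : ℕ) (hat : a + t < B)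
    {i j : Fin n} (hi : Bone M L X a b i) (hj : Bone M L X (a + t) b j) :
    Within (3 * L + 7 * L * t) r X i j := by
  induction t generalizing j with
  | zero => exact hi.within hT (h a (by omega) b hb) hj
  | succ t ih =>
    obtain ⟨k, hk⟩ := exists_bone (h (a + t) (by omega) b hb)
    exact ((ih (by omega) hk).trans (hk.within_right hT (h _ (by omega) b hb)
      (h _ (by omega) b hb) hj)).mono (by ring_nf; omega)

theorem Bone.within_vertical (hT : TouchHop M r X)
    (h : ∀ a < B, ∀ b < B, FewEmpty M L X a b) (ha : a < B) (t : ℕ) (hbt : b + t < B)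
    {i j : Fin n} (hi : Bone M L X a b i) (hj : Bone M L X a (b + t) j) :
    Within (3 * L + 7 * L * t) r X i j := by
  induction t generalizing j with
  | zero => exact hi.within hT (h a ha b (by omega)) hj
  | succ t ih =>
    obtain ⟨k, hk⟩ := exists_bone (h a ha (b + t) (by omega))
    exact ((ih (by omega) hk).trans (hk.within_up hT (h _ ha _ (by omega))
      (h _ ha _ (by omega)) hj)).mono (by ring_nf; omega)

/-- When all blocks have few empty cells, the occupied rows of two blocks are joined by paths
whose length is proportional to the distance of the blocks. -/
theorem Bone.within_of_close (hT : TouchHop M r X)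
    (h : ∀ a < B, ∀ b < B, FewEmpty M L X a b) {a' b' D : ℕ} (ha : a < B) (hb : b < B)
    (ha' : a' < B) (hb' : b' < B) (h1 : a < a' + D) (h2 : a' < a + D) (h3 : b < b' + D)
    (h4 : b' < b + D) {i j : Fin n} (hi : Bone M L X a b i) (hj : Bone M L X a' b' j) :
    Within (14 * L * D) r X i j := by
  -- Turn once, at the block in the column of the target and the row of the start.
  obtain ⟨k, hk⟩ := exists_bone (h a' ha' b hb)
  have hbound : ∀ t < D, 3 * L + 7 * L * t ≤ 7 * L * D := by
    intro t ht
    calc 3 * L + 7 * L * t ≤ 7 * L * (t + 1) := by ring_nf; omega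
      _ ≤ 7 * L * D := Nat.mul_le_mul_left _ ht
  have hik : Within (7 * L * D) r X i k := by
    rcases le_total a a' with hle | hle
    · obtain ⟨t, rfl⟩ := Nat.exists_eq_add_of_le hle
      exact (hi.within_horizontal hT h hb t ha' hk).mono (hbound t (by omega))
    · obtain ⟨t, rfl⟩ := Nat.exists_eq_add_of_le hle
      exact (hk.within_horizontal hT h hb t ha hi).symm.mono (hbound t (by omega))
  have hkj : Within (7 * L * D) r X k j := by
    rcases le_total b b' with hle | hle
    · obtain ⟨t, rfl⟩ := Nat.exists_eq_add_of_le hle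
      exact (hk.within_vertical hT h ha' t hb' hj).mono (hbound t (by omega))
    · obtain ⟨t, rfl⟩ := Nat.exists_eq_add_of_le hle
      exact (hj.within_vertical hT h ha' t hb hk).symm.mono (hbound t (by omega))
  exact (hik.trans hkj).mono (by ring_nf; omega)

end Occupied

/-! ### Counting pairs -/

/-- Cauchy–Schwarz: `W ^ 2` classes contain at least `N.card ^ 2 / W ^ 2` ordered pairs of equal
class. The summand `n` pays for the diagonal pairs, which `reach` omits. -/
theorem sq_card_le_reachCount {n : ℕ} {H : ℕ} {r : ℝ} {X : Fin n → Plane} (N : Finset (Fin n))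
    (φ : Fin n → ℕ × ℕ) (W : ℕ) (hφ : ∀ i ∈ N, φ i ∈ Finset.range W ×ˢ Finset.range W)
    (h : ∀ i ∈ N, ∀ j ∈ N, φ i = φ j → Within H r X i j) :
    N.card ^ 2 ≤ W ^ 2 * (reachCount H r X + n) := by
  classical
  set T := Finset.range W ×ˢ Finset.range W
  have hcs : (∑ t ∈ T, (N.filter fun i => φ i = t).card) ^ 2 ≤
      T.card * ∑ t ∈ T, (N.filter fun i => φ i = t).card ^ 2 := sq_sum_le_card_mul_sum_sq
  rw [← Finset.card_eq_sum_card_fiberwise hφ] at hcs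
  have hT : T.card = W ^ 2 := by simp [T, sq]
  rw [hT] at hcs
  refine hcs.trans (Nat.mul_le_mul_left _ ?_)
  calc ∑ t ∈ T, (N.filter fun i => φ i = t).card ^ 2
      = ∑ t ∈ T, ∑ i ∈ N.filter (fun i => φ i = t), (N.filter fun j => φ j = φ i).card := by
        refine Finset.sum_congr rfl fun t _ => ?_
        rw [Finset.sum_congr rfl (g := fun _ => (N.filter fun j => φ j = t).card)]
        · rw [Finset.sum_const, smul_eq_mul, sq]
        · intro i hi
          rw [(Finset.mem_filter.1 hi).2]
    _ = ∑ i ∈ N, (N.filter fun j => φ j = φ i).card := Finset.sum_fiberwise_of_maps_to hφ _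
    _ ≤ ∑ i ∈ N, ((reach H r X i).card + 1) := by
        refine Finset.sum_le_sum fun i hi => ?_
        refine le_trans (Finset.card_le_card ?_) (Finset.card_insert_le i (reach H r X i))
        intro j hj
        rw [Finset.mem_filter] at hj
        rw [Finset.mem_insert]
        by_cases hji : j = i
        · exact Or.inl hji
        · right
          simp only [reach, Finset.mem_filter, Finset.mem_univ, true_and]
          exact ⟨hji, h i hi j hj.1 hj.2.symm⟩
    _ ≤ ∑ i : Fin n, ((reach H r X i).card + 1) :=
        Finset.sum_le_sum_of_subset (Finset.subset_univ _)
    _ = _ := by simp [Finset.sum_add_distrib, reachCount]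

/-! ### The probability of empty cells -/

theorem measurable_cell (M : ℕ) : Measurable (cell M) := by
  unfold cell
  exact (Nat.measurable_floor.comp (by fun_prop)).prodMk (Nat.measurable_floor.comp (by fun_prop))

theorem ae_mem_unitSquare : ∀ᵐ x ∂squareLaw, x ∈ unitSquare :=
  ae_restrict_mem measurableSet_unitSquare

theorem squareLaw_real_cell_eq {M : ℕ} {c : ℕ × ℕ} (h1 : c.1 < M) (h2 : c.2 < M) :
    squareLaw.real (cell M ⁻¹' {c}) = 1 / M ^ 2 := by
  have hM : (0 : ℝ) < M := by exact_mod_cast (Nat.zero_le _).trans_lt h1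
  have h1' : (c.1 + 1 : ℝ) ≤ M := by exact_mod_cast h1
  have h2' : (c.2 + 1 : ℝ) ≤ M := by exact_mod_cast h2
  -- The cell agrees with a half-open box only almost everywhere: the natural-number floor sends
  -- negative coordinates to zero.
  have hbox : squareLaw.real (cell M ⁻¹' {c}) =
      squareLaw.real (box ![c.1 / M, c.2 / M] ![(c.1 + 1) / M, (c.2 + 1) / M]) := by
    refine measureReal_congr ?_
    filter_upwards [ae_mem_unitSquare] with x hx
    have h0 := (hx 0).1
    have h1 := (hx 1).1
    refine propext ?_
    change cell M x = c ↔ ∀ i, _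
    rw [Fin.forall_fin_two, cell, Prod.ext_iff]
    simp only [Nat.floor_eq_iff (mul_nonneg hM.le h0), Nat.floor_eq_iff (mul_nonneg hM.le h1),
      Set.mem_Ico, Matrix.cons_val_zero, Matrix.cons_val_one, div_le_iff₀ hM, lt_div_iff₀ hM,
      mul_comm]
  rw [hbox, squareLaw_box]
  · simp only [Matrix.cons_val_zero, Matrix.cons_val_one]
    field_simp
    ring
  · rw [Fin.forall_fin_two]
    simp only [Matrix.cons_val_zero, Matrix.cons_val_one]
    exact ⟨by positivity, by positivity⟩
  · rw [Fin.forall_fin_two]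
    simp only [Matrix.cons_val_zero, Matrix.cons_val_one, div_le_one hM]
    exact ⟨h1', h2'⟩
  · rw [Fin.forall_fin_two]
    simp only [Matrix.cons_val_zero, Matrix.cons_val_one]
    constructor <;> gcongr <;> linarith

/-- The cells of the unit square. -/
def cells (M : ℕ) : Finset (ℕ × ℕ) := Finset.range M ×ˢ Finset.range M

theorem mem_cells {M : ℕ} {c : ℕ × ℕ} : c ∈ cells M ↔ c.1 < M ∧ c.2 < M := by
  simp [cells]

theorem card_cells (M : ℕ) : (cells M).card = M ^ 2 := by simp [cells, sq]

theorem squareLaw_real_cell_mem {M : ℕ} {C : Finset (ℕ × ℕ)} (hC : C ⊆ cells M) :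
    squareLaw.real (cell M ⁻¹' C) = C.card / M ^ 2 := by
  rw [← sum_measureReal_preimage_singleton _ fun c _ =>
    measurable_cell M (measurableSet_singleton c)]
  rw [Finset.sum_congr rfl fun c hc =>
    squareLaw_real_cell_eq (mem_cells.1 (hC hc)).1 (mem_cells.1 (hC hc)).2]
  rw [Finset.sum_const, nsmul_eq_mul]
  ring

theorem posLaw_real_pi {n : ℕ} (s : Fin n → Set Plane) :
    (posLaw n).real (Set.univ.pi s) = ∏ i, squareLaw.real (s i) := by
  rw [posLaw, measureReal_def, Measure.pi_pi, ENNReal.toReal_prod]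
  rfl

theorem ae_pos_mem {n : ℕ} {s : Set Plane} (hs : ∀ᵐ x ∂squareLaw, x ∈ s) :
    ∀ᵐ X ∂(posLaw n), ∀ i, X i ∈ s :=
  ae_all_iff.2 fun i =>
    (measurePreserving_eval (fun _ : Fin n => squareLaw) i).quasiMeasurePreserving.ae hs

/-- The `M ^ 2` cells have total mass one, so the points on the far sides of the square, whose index
is `M`, form a null set. -/
theorem ae_cell_mem_cells {M : ℕ} (hM : 0 < M) : ∀ᵐ x ∂squareLaw, cell M x ∈ cells M := by
  have hms : MeasurableSet {x | cell M x ∈ cells M} :=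
    measurable_cell M (cells M).measurableSet
  have h : squareLaw.real (cell M ⁻¹' (cells M)) = 1 := by
    have hM' : (M : ℝ) ≠ 0 := by exact_mod_cast hM.ne'
    rw [squareLaw_real_cell_mem subset_rfl, card_cells]
    push_cast
    field_simp
  refine (prob_compl_eq_zero_iff hms).2 ?_
  rw [measureReal_def] at h
  exact (ENNReal.toReal_eq_one_iff _).1 h

theorem one_sub_pow_le_exp {x : ℝ} (hx : x ≤ 1) (k : ℕ) :
    (1 - x) ^ k ≤ Real.exp (-(k * x)) := by
  calc (1 - x) ^ k ≤ Real.exp (-x) ^ k := by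
        exact pow_le_pow_left₀ (by linarith) (by linarith [Real.add_one_le_exp (-x)]) k
    _ = _ := by rw [← Real.exp_nat_mul]; ring_nf

theorem posLaw_real_all_empty_le {n M : ℕ} (hM : 0 < M) {C : Finset (ℕ × ℕ)} (hC : C ⊆ cells M) :
    (posLaw n).real {X | ∀ c ∈ C, ¬ Occ M X c} ≤ Real.exp (-(n * (C.card / M ^ 2))) := by
  have hset : {X : Fin n → Plane | ∀ c ∈ C, ¬ Occ M X c} =
      Set.univ.pi fun _ => (cell M ⁻¹' C)ᶜ := by
    ext X
    simp only [Set.mem_ofPred_eq, Occ, Set.mem_univ_pi, Set.mem_compl_iff, Set.mem_preimage,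
      Finset.mem_coe]
    exact ⟨fun h i hi => h _ hi ⟨i, rfl⟩, fun h c hc ⟨i, hi⟩ => h i (hi ▸ hc)⟩
  rw [hset, posLaw_real_pi, Finset.prod_const, Finset.card_univ, Fintype.card_fin,
    probReal_compl_eq_one_sub (measurable_cell M C.measurableSet), squareLaw_real_cell_mem hC]
  refine one_sub_pow_le_exp ?_ n
  have hM' : (0 : ℝ) < M := by exact_mod_cast hM
  rw [div_le_one (by positivity)]
  have := Finset.card_le_card hC
  rw [card_cells] at this
  exact_mod_cast this

/-- A bad block contains `K` cells that are all empty. Union bound over the subsets of the block, at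
most `2 ^ ((2 * K) ^ 2)` in number, a constant once `K` is fixed. -/
theorem posLaw_real_not_fewEmpty_le {n M K a b : ℕ} (hM : 0 < M) (ha : (a + 1) * (2 * K) ≤ M)
    (hb : (b + 1) * (2 * K) ≤ M) :
    (posLaw n).real {X | ¬ FewEmpty M (2 * K) X a b} ≤
      2 ^ ((2 * K) ^ 2) * Real.exp (-(n * (K / M ^ 2))) := by
  classical
  set Q := span (2 * K) a ×ˢ span (2 * K) b with hQ
  have hQsub : Q ⊆ cells M := by
    intro c hc
    simp only [hQ, span, Finset.mem_product, Finset.mem_Ico] at hc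
    rw [mem_cells]
    rw [add_mul, one_mul] at ha hb
    omega
  have hQcard : Q.card = (2 * K) ^ 2 := by simp [hQ, span, sq]
  have hsub : {X : Fin n → Plane | ¬ FewEmpty M (2 * K) X a b} ⊆
      ⋃ C ∈ Q.powersetCard K, {X | ∀ c ∈ C, ¬ Occ M X c} := by
    intro X hX
    simp only [FewEmpty, Set.mem_ofPred_eq, not_lt] at hX
    obtain ⟨C, hC, hCK⟩ := Finset.exists_subset_card_eq (s := emptyCells M (2 * K) X a b)
      (n := K) (by omega)
    simp only [Set.mem_iUnion, Finset.mem_powersetCard]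
    exact ⟨C, ⟨hC.trans (Finset.filter_subset _ _), hCK⟩, fun c hc =>
      (Finset.mem_filter.1 (hC hc)).2⟩
  calc _ ≤ (posLaw n).real (⋃ C ∈ Q.powersetCard K, {X | ∀ c ∈ C, ¬ Occ M X c}) :=
        measureReal_mono hsub (measure_ne_top _ _)
    _ ≤ ∑ C ∈ Q.powersetCard K, (posLaw n).real {X | ∀ c ∈ C, ¬ Occ M X c} :=
        measureReal_biUnion_finset_le _ _
    _ ≤ ∑ C ∈ Q.powersetCard K, Real.exp (-(n * (K / M ^ 2))) := by
        refine Finset.sum_le_sum fun C hC => ?_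
        rw [Finset.mem_powersetCard] at hC
        have := posLaw_real_all_empty_le (n := n) hM (hC.1.trans hQsub)
        rwa [hC.2] at this
    _ ≤ _ := by
        rw [Finset.sum_const, nsmul_eq_mul]
        gcongr
        rw [← hQcard, ← Nat.cast_ofNat (R := ℝ), ← Nat.cast_pow, ← Finset.card_powerset]
        exact_mod_cast Finset.card_le_card
          (fun C hC => Finset.mem_powerset.2 (Finset.mem_powersetCard.1 hC).1)

/-- The block of `L * L` cells that contains the cell `c`. -/
def blockOf (L : ℕ) (c : ℕ × ℕ) : Finset (ℕ × ℕ) := span L (c.1 / L) ×ˢ span L (c.2 / L)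

theorem mem_span_iff {L : ℕ} (hL : 0 < L) {u a : ℕ} : u ∈ span L a ↔ u / L = a := by
  rw [span, Finset.mem_Ico, Nat.div_eq_iff hL]
  omega

/-- An event that contains the event that the block of the node `i` has an empty cell. -/
def gapEvent (M L : ℕ) {n : ℕ} (i : Fin n) : Set (Fin n → Plane) :=
  ⋃ c ∈ cells M, Set.univ.pi fun j =>
    if j = i then cell M ⁻¹' (blockOf L c) else (cell M ⁻¹' {c})ᶜ

theorem measurableSet_gapEvent (M L : ℕ) {n : ℕ} (i : Fin n) :
    MeasurableSet (gapEvent M L i) := by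
  refine Finset.measurableSet_biUnion _ fun c _ => MeasurableSet.univ_pi fun j => ?_
  split_ifs
  · exact measurable_cell M (blockOf L c).measurableSet
  · exact (measurable_cell M (measurableSet_singleton c)).compl

/-- For an empty cell `c` of its block, `i` lies in the block of `c` and all other nodes miss `c`.
Asking nothing more of `i` gives `gapEvent` its product form. Since `L` divides `M`, blocks do not
stick out of the square. -/
theorem occ_of_notMem_gapEvent {M L B n : ℕ} (hL : 0 < L) (hM : M = L * B) {X : Fin n → Plane}
    {i : Fin n} (hX : cell M (X i) ∈ cells M) (hgap : X ∉ gapEvent M L i) {c : ℕ × ℕ}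
    (hc : c ∈ blockOf L (cell M (X i))) : Occ M X c := by
  by_contra hocc
  apply hgap
  simp only [blockOf, Finset.mem_product, mem_span_iff hL] at hc
  simp only [mem_cells] at hX
  have hlt : ∀ u v : ℕ, u / L = v / L → v < M → u < M := by
    intro u v h hv
    rw [hM, mul_comm] at hv ⊢
    rw [← Nat.div_lt_iff_lt_mul hL] at hv ⊢
    omega
  simp only [gapEvent, Set.mem_iUnion]
  refine ⟨c, mem_cells.2 ⟨hlt _ _ hc.1 hX.1, hlt _ _ hc.2 hX.2⟩, fun j _ => ?_⟩
  dsimp only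
  split_ifs with h
  · subst h
    simp only [Set.mem_preimage, Finset.mem_coe, blockOf, Finset.mem_product, mem_span_iff hL]
    exact ⟨hc.1.symm, hc.2.symm⟩
  · exact fun hj => hocc ⟨j, hj⟩

/-- The position of `i` contributes `L ^ 2 / M ^ 2` for each cell, which cancels the number `M ^ 2`
of cells: no polynomial factor is left in front of the exponential. -/
theorem posLaw_real_gapEvent_le {M L B n : ℕ} (hL : 0 < L) (hB : 0 < B) (hM : M = L * B)
    (i : Fin n) :
    (posLaw n).real (gapEvent M L i) ≤ L ^ 2 * Real.exp (-((n - 1 : ℕ) * (1 / M ^ 2))) := by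
  have hM0 : 0 < M := by rw [hM]; positivity
  have hM' : (0 : ℝ) < M := by exact_mod_cast hM0
  have hblock : ∀ c ∈ cells M, blockOf L c ⊆ cells M := by
    intro c hc d hd
    simp only [blockOf, Finset.mem_product, mem_span_iff hL] at hd
    rw [mem_cells] at hc ⊢
    rw [hM, mul_comm, ← Nat.div_lt_iff_lt_mul hL, ← Nat.div_lt_iff_lt_mul hL] at hc ⊢
    omega
  have hcard : ∀ c, (blockOf L c).card = L ^ 2 := fun c => by simp [blockOf, span, sq]
  calc _ ≤ ∑ c ∈ cells M, (posLaw n).real (Set.univ.pi fun j =>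
        if j = i then cell M ⁻¹' (blockOf L c) else (cell M ⁻¹' {c})ᶜ) :=
        measureReal_biUnion_finset_le _ _
    _ ≤ ∑ c ∈ cells M, (L ^ 2 / M ^ 2 * Real.exp (-((n - 1 : ℕ) * (1 / M ^ 2)))) := by
        refine Finset.sum_le_sum fun c hc => ?_
        rw [posLaw_real_pi, ← Finset.mul_prod_erase _ _ (Finset.mem_univ i), if_pos rfl,
          squareLaw_real_cell_mem (hblock c hc), hcard]
        rw [Finset.prod_congr rfl (g := fun _ => 1 - 1 / (M : ℝ) ^ 2), Finset.prod_const,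
          Finset.card_erase_of_mem (Finset.mem_univ i), Finset.card_univ, Fintype.card_fin]
        · push_cast
          gcongr
          refine one_sub_pow_le_exp ?_ _
          rw [div_le_one (by positivity)]
          have h1 : (1 : ℝ) ≤ M := by exact_mod_cast hM0
          exact one_le_pow₀ h1
        · intro j hj
          rw [if_neg (Finset.ne_of_mem_erase hj),
            probReal_compl_eq_one_sub (measurable_cell M (measurableSet_singleton c)),
            squareLaw_real_cell_eq (mem_cells.1 hc).1 (mem_cells.1 hc).2]
    _ = _ := by
        rw [Finset.sum_const, card_cells, nsmul_eq_mul]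
        push_cast
        field_simp

/-! ### The number of pairs of nodes within `H` hops -/

/-- The deterministic core. At least half of the nodes have a completely occupied block and hence
lie on a `Bone`; two of these in the same group of `D * D` blocks are within `14 * L * D ≤ H` hops.
-/
theorem sq_le_reachCount_of_good {n H K D W : ℕ} {r : ℝ} {X : Fin n → Plane} {M : ℕ} (hK : 0 < K)
    (hD : 0 < D) (hM : M = 2 * K * (D * W)) (hH : 14 * (2 * K) * D ≤ H)
    (hT : TouchHop M r X) (hcell : ∀ i, cell M (X i) ∈ cells M)
    (hfew : ∀ a < D * W, ∀ b < D * W, FewEmpty M (2 * K) X a b)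
    (hgap : ∑ i, (gapEvent M (2 * K) i).indicator (fun _ => (1 : ℝ)) X ≤ n / 2) :
    (n / 2 : ℝ) ^ 2 ≤ W ^ 2 * (reachCount H r X + n) := by
  classical
  set L := 2 * K with hLdef
  have hL : 0 < L := by omega
  set N : Finset (Fin n) := Finset.univ.filter fun i => X ∉ gapEvent M L i with hN
  have hNcard : (n / 2 : ℝ) ≤ N.card := by
    have h1 : (N.card : ℝ) + ∑ i, (gapEvent M L i).indicator (fun _ => (1 : ℝ)) X = n := by
      rw [hN, Finset.card_filter]
      push_cast
      rw [← Finset.sum_add_distrib, Finset.sum_congr rfl (g := fun _ => (1 : ℝ))]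
      · simp
      · intro i _
        by_cases h : X ∈ gapEvent M L i <;> simp [h]
    linarith
  set φ : Fin n → ℕ × ℕ := fun i => ((cell M (X i)).1 / L / D, (cell M (X i)).2 / L / D) with hφ
  have hlt : ∀ u < M, u / L < D * W := by
    intro u hu
    rw [Nat.div_lt_iff_lt_mul hL, mul_comm]
    rwa [hM] at hu
  have hbone : ∀ i ∈ N, Bone M L X ((cell M (X i)).1 / L) ((cell M (X i)).2 / L) i := by
    intro i hi
    refine ⟨(mem_span_iff hL).2 rfl, (mem_span_iff hL).2 rfl, fun u hu => ?_⟩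
    refine occ_of_notMem_gapEvent hL hM (hcell i) (Finset.mem_filter.1 hi).2 ?_
    simp only [blockOf, Finset.mem_product]
    exact ⟨hu, (mem_span_iff hL).2 rfl⟩
  have hclose : ∀ x y : ℕ, x / D = y / D → x < y + D := by
    intro x y h
    have h1 := Nat.div_add_mod x D
    have h2 := Nat.div_add_mod y D
    have h3 := Nat.mod_lt x hD
    rw [h] at h1
    omega
  have key := sq_card_le_reachCount (H := H) (r := r) (X := X) N φ W
    (by
      intro i _
      have hc := mem_cells.1 (hcell i)
      simp only [hφ, Finset.mem_product, Finset.mem_range, Nat.div_lt_iff_lt_mul hD]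
      rw [mul_comm W D]
      exact ⟨hlt _ hc.1, hlt _ hc.2⟩)
    (by
      intro i hi j hj hij
      simp only [hφ, Prod.mk.injEq] at hij
      have hci := mem_cells.1 (hcell i)
      have hcj := mem_cells.1 (hcell j)
      exact (Bone.within_of_close hT hfew (hlt _ hci.1) (hlt _ hci.2) (hlt _ hcj.1) (hlt _ hcj.2)
        (hclose _ _ hij.1) (hclose _ _ hij.1.symm) (hclose _ _ hij.2) (hclose _ _ hij.2.symm)
        (hbone i hi) (hbone j hj)).mono hH)
  calc (n / 2 : ℝ) ^ 2 ≤ (N.card : ℝ) ^ 2 := by gcongr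
    _ ≤ _ := by exact_mod_cast key

/-- The two summands bound the failure modes: a block with too many empty cells, and, by Markov's
inequality, at least `n / 2` nodes with a gap event. -/
theorem posLaw_real_reachCount_lt_le {n H K D W : ℕ} {r : ℝ} {M : ℕ} (hn : 0 < n) (hK : 0 < K)
    (hD : 0 < D) (hW : 0 < W) (hM : M = 2 * K * (D * W)) (hH : 14 * (2 * K) * D ≤ H)
    (hr : 3 ≤ M * r) :
    (posLaw n).real {X | W ^ 2 * ((reachCount H r X : ℝ) + n) < (n / 2) ^ 2} ≤
      M ^ 2 * (2 ^ ((2 * K) ^ 2) * Real.exp (-(n * (K / M ^ 2)))) +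
        2 * ((2 * K : ℕ) ^ 2 * Real.exp (-((n - 1 : ℕ) * (1 / M ^ 2)))) := by
  have hM0 : 0 < M := by rw [hM]; positivity
  have hn' : (0 : ℝ) < n := by exact_mod_cast hn
  -- Here `cells (D * W)` indexes the blocks, of which there are `D * W` in each direction.
  set F : Set (Fin n → Plane) := ⋃ c ∈ cells (D * W), {X | ¬ FewEmpty M (2 * K) X c.1 c.2}
  set G : Set (Fin n → Plane) :=
    {X | (n / 2 : ℝ) ≤ ∑ i, (gapEvent M (2 * K) i).indicator (fun _ => (1 : ℝ)) X}
  have hF : (posLaw n).real F ≤ M ^ 2 * (2 ^ ((2 * K) ^ 2) * Real.exp (-(n * (K / M ^ 2)))) := by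
    have hle : ∀ a < D * W, (a + 1) * (2 * K) ≤ M := by
      intro a ha
      rw [hM, mul_comm (2 * K)]
      exact Nat.mul_le_mul_right _ ha
    calc (posLaw n).real F ≤
        ∑ c ∈ cells (D * W), (posLaw n).real {X | ¬ FewEmpty M (2 * K) X c.1 c.2} :=
          measureReal_biUnion_finset_le _ _
      _ ≤ ∑ c ∈ cells (D * W), (2 ^ ((2 * K) ^ 2) * Real.exp (-(n * (K / M ^ 2)))) := by
          refine Finset.sum_le_sum fun c hc => ?_
          rw [mem_cells] at hc
          exact posLaw_real_not_fewEmpty_le hM0 (hle _ hc.1) (hle _ hc.2)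
      _ ≤ _ := by
          rw [Finset.sum_const, nsmul_eq_mul, card_cells]
          gcongr
          have : (D * W) ^ 2 ≤ M ^ 2 := by
            rw [hM]
            exact Nat.pow_le_pow_left (Nat.le_mul_of_pos_left _ (by omega)) 2
          exact_mod_cast this
  have hG : (posLaw n).real G ≤
      2 * ((2 * K : ℕ) ^ 2 * Real.exp (-((n - 1 : ℕ) * (1 / M ^ 2)))) := by
    refine (measureReal_count_ge_le (measurableSet_gapEvent M (2 * K)) (by positivity)).trans ?_
    rw [div_le_iff₀ (by positivity)]
    calc _ ≤ ∑ _i : Fin n, ((2 * K : ℕ) ^ 2 * Real.exp (-((n - 1 : ℕ) * (1 / M ^ 2))) : ℝ) :=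
          Finset.sum_le_sum fun i _ =>
            posLaw_real_gapEvent_le (by omega) (Nat.mul_pos hD hW) hM i
      _ = _ := by
          rw [Finset.sum_const, Finset.card_univ, Fintype.card_fin, nsmul_eq_mul]
          ring
  refine le_trans ?_ (add_le_add hF hG)
  refine le_trans ?_ (measureReal_union_le F G)
  refine ENNReal.toReal_mono (measure_ne_top _ _) (measure_mono_ae ?_)
  filter_upwards [ae_pos_mem (n := n) (ae_cell_mem_cells hM0), ae_pos_mem (n := n)
    ae_mem_unitSquare] with X hX hX'
  intro hlt
  by_contra hnot
  have hnot' : ¬ (X ∈ F ∨ X ∈ G) := hnot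
  rw [not_or] at hnot'
  refine absurd (sq_le_reachCount_of_good hK hD hM hH
    (touchHop_of_le hM0 hr fun i k => (hX' i k).1) hX ?_ ?_) (not_le.2 hlt)
  · intro a ha b hb
    by_contra hab
    refine hnot'.1 ?_
    simp only [F, Set.mem_iUnion]
    exact ⟨(a, b), mem_cells.2 ⟨ha, hb⟩, hab⟩
  · exact (not_le.1 hnot'.2).le

/-- For bounded `H` single cells serve as classes: their nodes are one hop apart, and no occupancy
estimate is needed. -/
theorem ae_sq_le_reachCount {n H M : ℕ} {r : ℝ} (hM0 : 0 < M) (hH : 1 ≤ H) (hr : 3 ≤ M * r) :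
    ∀ᵐ X ∂(posLaw n), (n : ℝ) ^ 2 ≤ M ^ 2 * (reachCount H r X + n) := by
  filter_upwards [ae_pos_mem (n := n) (ae_cell_mem_cells hM0), ae_pos_mem (n := n)
    ae_mem_unitSquare] with X hX hX'
  have hT := touchHop_of_le hM0 hr fun i k => (hX' i k).1
  have key := sq_card_le_reachCount (H := H) (r := r) (X := X) Finset.univ (fun i => cell M (X i)) M
    (fun i _ => hX i)
    (fun i _ j _ hij => (hT i j (by
      rw [hij]
      simp [Touch])).mono hH)
  rw [Finset.card_univ, Fintype.card_fin] at key
  exact_mod_cast key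

/-! ### The number of pairs within `H` hops in the regime of the theorem -/

theorem mul_log_le_of_range {n : ℕ} {β₁ r : ℝ} (hn : 3 ≤ n) (hβ₁ : 0 < β₁)
    (hr : β₁ * √(Real.log n / n) ≤ r) :
    1 ≤ Real.log n ∧ 0 < r ∧ β₁ ^ 2 * Real.log n ≤ n * r ^ 2 := by
  have hn' : (3 : ℝ) ≤ n := by exact_mod_cast hn
  have hlog : 1 ≤ Real.log n := by
    rw [Real.le_log_iff_exp_le (by linarith)]
    linarith [Real.exp_one_lt_d9]
  have hpos : 0 < Real.log n / n := by positivity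
  refine ⟨hlog, lt_of_lt_of_le (by positivity) hr, ?_⟩
  have h1 : (β₁ * √(Real.log n / n)) ^ 2 ≤ r ^ 2 := pow_le_pow_left₀ (by positivity) hr 2
  rw [mul_pow, Real.sq_sqrt hpos.le] at h1
  have h2 : (n : ℝ) * (β₁ ^ 2 * (Real.log n / n)) ≤ n * r ^ 2 := by gcongr
  have h3 : (n : ℝ) * (β₁ ^ 2 * (Real.log n / n)) = β₁ ^ 2 * Real.log n := by field_simp
  linarith

/-- The probability that few pairs of nodes are within `H` hops is at most this. -/
noncomputable def reachError (β₁ : ℝ) (K n : ℕ) : ℝ :=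
  16 * 2 ^ ((2 * K) ^ 2) / β₁ ^ 2 / n + 2 * (2 * K : ℕ) ^ 2 * Real.exp (-(β₁ ^ 2 / 32 * Real.log n))

theorem tendsto_log_natCast : Tendsto (fun n : ℕ => Real.log n) atTop atTop :=
  Real.tendsto_log_atTop.comp tendsto_natCast_atTop_atTop

theorem tendsto_reachError {β₁ : ℝ} (hβ₁ : 0 < β₁) (K : ℕ) :
    Tendsto (reachError β₁ K) atTop (𝓝 0) := by
  have h1 : Tendsto (fun n : ℕ => 16 * 2 ^ ((2 * K) ^ 2) / β₁ ^ 2 / (n : ℝ)) atTop (𝓝 0) :=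
    tendsto_const_nhds.div_atTop tendsto_natCast_atTop_atTop
  have h2 : Tendsto (fun n : ℕ => Real.exp (-(β₁ ^ 2 / 32 * Real.log n))) atTop (𝓝 0) :=
    Real.tendsto_exp_neg_atTop_nhds_zero.comp
      (tendsto_log_natCast.const_mul_atTop (by positivity))
  have := h1.add (h2.const_mul (2 * ((2 * K : ℕ) : ℝ) ^ 2))
  rw [mul_zero, add_zero] at this
  exact this

theorem reachError_nonneg {β₁ : ℝ} (K n : ℕ) : 0 ≤ reachError β₁ K n := by
  unfold reachError; positivity

/-- The number of blocks and of their groups, for a transmission range `r`. -/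
theorem exists_grid {H K : ℕ} {r : ℝ} (hr0 : 0 < r) (hHr : (H : ℝ) * r ≤ 1) (hK : 0 < K)
    (hH : 28 * K ≤ H) : ∃ D W : ℕ, 0 < D ∧ 0 < W ∧ 14 * (2 * K) * D ≤ H ∧
      3 ≤ ((2 * K * (D * W) : ℕ) : ℝ) * r ∧ ((2 * K * (D * W) : ℕ) : ℝ) * r ≤ 4 ∧
      W * (H * r) ≤ 112 := by
  have hK' : (0 : ℝ) < K := by exact_mod_cast hK
  -- The largest `D` with `14 * (2 * K) * D ≤ H`; rounding down loses at most a factor 2, since `28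
  -- * K ≤ H`.
  obtain ⟨D, hD⟩ : ∃ D, D = H / (28 * K) := ⟨_, rfl⟩
  have hD0 : 0 < D := hD ▸ Nat.div_pos hH (by omega)
  have hDle : 28 * K * D ≤ H := hD ▸ Nat.mul_div_le H (28 * K)
  have hDge : H < 28 * K * (D + 1) := hD ▸ Nat.lt_mul_div_succ H (show 0 < 28 * K by omega)
  have hD' : (1 : ℝ) ≤ D := by exact_mod_cast hD0
  have hDle' : (28 * K * D : ℝ) ≤ H := by exact_mod_cast hDle
  have hDge' : (H : ℝ) ≤ 28 * K * (D + 1) := by exact_mod_cast hDge.le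
  obtain ⟨d, hd⟩ : ∃ d : ℝ, d = 2 * K * D := ⟨_, rfl⟩
  have hd0 : 0 < d := by rw [hd]; positivity
  have hKD : (K : ℝ) ≤ K * D := le_mul_of_one_le_right hK'.le hD'
  have hHd : (H : ℝ) ≤ 28 * d := by rw [hd]; linarith
  have hdr : d * r ≤ 1 := by
    have hdH : d ≤ H := by rw [hd]; linarith
    exact (mul_le_mul_of_nonneg_right hdH hr0.le).trans hHr
  have hdr0 : 0 < d * r := by positivity
  -- The groups have `d = 2 * K * D` cells per side. Rounding up adds `d * r ≤ 1`, so `M * r` stays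
  -- between 3 and 4; with `H ≤ 28 * d` this gives `112 = 28 * 4`.
  obtain ⟨W, hW⟩ : ∃ W, W = ⌈3 / (d * r)⌉₊ := ⟨_, rfl⟩
  have hW0 : 0 < W := hW ▸ Nat.ceil_pos.2 (by positivity)
  have hW1 : 3 ≤ W * (d * r) := by
    have := Nat.le_ceil (3 / (d * r))
    rw [← hW] at this
    rwa [div_le_iff₀ hdr0] at this
  have hW2 : W * (d * r) ≤ 4 := by
    have := Nat.ceil_lt_add_one (show 0 ≤ 3 / (d * r) by positivity)
    rw [← hW] at this
    have h2 : (W : ℝ) * (d * r) ≤ (3 / (d * r) + 1) * (d * r) := by gcongr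
    rw [add_mul, div_mul_cancel₀ _ hdr0.ne'] at h2
    linarith
  have hMd : ((2 * K * (D * W) : ℕ) : ℝ) * r = W * (d * r) := by rw [hd]; push_cast; ring
  refine ⟨D, W, hD0, hW0, by linarith, by rwa [hMd], by rwa [hMd], ?_⟩
  have : (W : ℝ) * (H * r) ≤ W * (28 * d * r) := by gcongr
  linarith

/-- Turns a deficit of pairs into a contradiction with Cauchy–Schwarz over `q ^ 2` classes. The
hypothesis `hκn` absorbs the diagonal term `n` into the main term. -/
theorem lt_sq_of_reachCount_lt {n H q : ℕ} {β₁ r κ B x : ℝ} (hn : 3 ≤ n) (hβ₁ : 0 < β₁)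
    (hr : β₁ * √(Real.log n / n) ≤ r) (hH : 1 ≤ H) (hκ0 : 0 < κ)
    (hκn : 1 ≤ κ * (β₁ ^ 2 * Real.log n)) (hq : 0 < q) (hqH : q * (H * r) ≤ B)
    (hx : x < κ * (n * (H ^ 2 * r ^ 2)) * n) :
    q ^ 2 * (x + n) < κ * (2 * B ^ 2) * n ^ 2 := by
  obtain ⟨hlog, hr0, hnr⟩ := mul_log_le_of_range hn hβ₁ hr
  have hn' : (3 : ℝ) ≤ n := by exact_mod_cast hn
  have hH1 : (1 : ℝ) ≤ (H : ℝ) ^ 2 := one_le_pow₀ (by exact_mod_cast hH)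
  have hq' : (0 : ℝ) < q := by exact_mod_cast hq
  have h1 : (n : ℝ) ≤ κ * (n * (H ^ 2 * r ^ 2)) * n := by
    refine le_mul_of_one_le_left (by linarith) ?_
    calc 1 ≤ κ * (β₁ ^ 2 * Real.log n) := hκn
      _ ≤ κ * (n * r ^ 2) := by gcongr
      _ = κ * (n * (1 * r ^ 2)) := by ring
      _ ≤ κ * (n * (H ^ 2 * r ^ 2)) := by gcongr
  calc (q : ℝ) ^ 2 * (x + n)
      < q ^ 2 * (κ * (n * (H ^ 2 * r ^ 2)) * n + κ * (n * (H ^ 2 * r ^ 2)) * n) :=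
        mul_lt_mul_of_pos_left (add_lt_add_of_lt_of_le hx h1) (by positivity)
    _ = 2 * κ * n ^ 2 * (q * (H * r)) ^ 2 := by ring
    _ ≤ 2 * κ * n ^ 2 * B ^ 2 := by gcongr
    _ = _ := by ring

theorem log_le_div_sq {n : ℕ} {β₁ r M : ℝ} (hn : 3 ≤ n) (hβ₁ : 0 < β₁)
    (hr : β₁ * √(Real.log n / n) ≤ r) (hM : 0 < M) (hMr : M * r ≤ 4) :
    β₁ ^ 2 * Real.log n / 16 ≤ n / M ^ 2 := by
  obtain ⟨hlog, hr0, hnr⟩ := mul_log_le_of_range hn hβ₁ hr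
  rw [div_le_div_iff₀ (by norm_num) (by positivity)]
  calc β₁ ^ 2 * Real.log n * M ^ 2 ≤ n * r ^ 2 * M ^ 2 := by gcongr
    _ = n * (M * r) ^ 2 := by ring
    _ ≤ n * 4 ^ 2 := by gcongr
    _ = n * 16 := by norm_num

/-- The choice `32 ≤ K * β₁ ^ 2` makes `K` simultaneous empty cells as unlikely as `n ^ (-2)`, which
beats the `M ^ 2 = O(n)` blocks. For the gap events any negative power of `n` suffices. -/
theorem posLaw_error_le {n K : ℕ} {β₁ M : ℝ} (hn : 3 ≤ n) (hβ₁ : 0 < β₁) (hM : 0 < M)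
    (hKβ : 32 ≤ K * β₁ ^ 2) (hratio : β₁ ^ 2 * Real.log n / 16 ≤ n / M ^ 2) :
    M ^ 2 * (2 ^ ((2 * K) ^ 2) * Real.exp (-(n * (K / M ^ 2)))) +
      2 * ((2 * K : ℕ) ^ 2 * Real.exp (-((n - 1 : ℕ) * (1 / M ^ 2)))) ≤ reachError β₁ K n := by
  have hn' : (3 : ℝ) ≤ n := by exact_mod_cast hn
  have hlog : 1 ≤ Real.log n := by
    rw [Real.le_log_iff_exp_le (by linarith)]
    linarith [Real.exp_one_lt_d9]
  refine add_le_add ?_ ?_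
  · have hMn : M ^ 2 ≤ 16 / β₁ ^ 2 * n := by
      rw [div_mul_eq_mul_div, le_div_iff₀ (by positivity)]
      rw [div_le_div_iff₀ (by norm_num) (by positivity)] at hratio
      calc M ^ 2 * β₁ ^ 2 = β₁ ^ 2 * 1 * M ^ 2 := by ring
        _ ≤ β₁ ^ 2 * Real.log n * M ^ 2 := by gcongr
        _ ≤ n * 16 := hratio
        _ = _ := mul_comm _ _
    have hexp : Real.exp (-(n * (K / M ^ 2))) ≤ 1 / (n : ℝ) ^ 2 := by
      have h1 : 2 * Real.log n ≤ n * (K / M ^ 2) := by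
        calc 2 * Real.log n = 32 * (Real.log n / 16) := by ring
          _ ≤ K * β₁ ^ 2 * (Real.log n / 16) := by gcongr
          _ = K * (β₁ ^ 2 * Real.log n / 16) := by ring
          _ ≤ K * (n / M ^ 2) := by gcongr
          _ = _ := by ring
      calc Real.exp (-(n * (K / M ^ 2))) ≤ Real.exp (-(2 * Real.log n)) := by gcongr
        _ = 1 / (n : ℝ) ^ 2 := by
          rw [Real.exp_neg, two_mul, Real.exp_add, Real.exp_log (by linarith)]
          ring
    have hb : (0 : ℝ) < 2 ^ ((2 * K) ^ 2) := by positivity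
    generalize (2 : ℝ) ^ ((2 * K) ^ 2) = b at hb ⊢
    calc M ^ 2 * (b * Real.exp (-(n * (K / M ^ 2))))
        ≤ (16 / β₁ ^ 2 * n) * (b * (1 / (n : ℝ) ^ 2)) := by gcongr
      _ = 16 * b / β₁ ^ 2 / n := by field_simp
  · rw [← mul_assoc]
    refine mul_le_mul_of_nonneg_left (Real.exp_le_exp.2 (neg_le_neg ?_)) (by positivity)
    rw [Nat.cast_sub (by omega), Nat.cast_one]
    calc β₁ ^ 2 / 32 * Real.log n = 1 / 2 * (β₁ ^ 2 * Real.log n / 16) := by ring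
      _ ≤ 1 / 2 * (n / M ^ 2) := by gcongr
      _ = (n / 2) * (1 / M ^ 2) := by ring
      _ ≤ _ := by
        gcongr
        linarith

theorem posLaw_real_reachCount_lt_of_large {n H K : ℕ} {β₁ r κ : ℝ} (hn : 3 ≤ n) (hβ₁ : 0 < β₁)
    (hr : β₁ * √(Real.log n / n) ≤ r) (hHr : (H : ℝ) * r ≤ 1) (hK : 0 < K)
    (hKβ : 32 ≤ K * β₁ ^ 2) (hH : 28 * K ≤ H) (hκ0 : 0 < κ) (hκ : κ * (8 * 112 ^ 2) ≤ 1)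
    (hκn : 1 ≤ κ * (β₁ ^ 2 * Real.log n)) :
    (posLaw n).real {X | (reachCount H r X : ℝ) < κ * (n * (H ^ 2 * r ^ 2)) * n} ≤
      reachError β₁ K n := by
  obtain ⟨hlog, hr0, hnr⟩ := mul_log_le_of_range hn hβ₁ hr
  obtain ⟨D, W, hD0, hW0, hDH, hM1, hM2, hWH⟩ := exists_grid hr0 hHr hK hH
  obtain ⟨M, hM⟩ : ∃ M, M = 2 * K * (D * W) := ⟨_, rfl⟩
  rw [← hM] at hM1 hM2
  have hM0 : (0 : ℝ) < M := by
    rw [hM]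
    exact_mod_cast Nat.mul_pos (by omega) (Nat.mul_pos hD0 hW0)
  refine le_trans (measureReal_mono fun X hX => ?_) ((posLaw_real_reachCount_lt_le (H := H)
    (r := r) (by omega) hK hD0 hW0 hM hDH hM1).trans
    (posLaw_error_le hn hβ₁ hM0 hKβ (log_le_div_sq hn hβ₁ hr hM0 hM2)))
  have hX' := lt_sq_of_reachCount_lt hn hβ₁ hr (by omega) hκ0 hκn hW0 hWH hX
  refine lt_of_lt_of_le hX' ?_
  calc κ * (2 * 112 ^ 2) * (n : ℝ) ^ 2 = κ * (8 * 112 ^ 2) * ((n : ℝ) / 2) ^ 2 := by ring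
    _ ≤ 1 * ((n : ℝ) / 2) ^ 2 := by gcongr
    _ = _ := one_mul _

theorem posLaw_real_reachCount_lt_of_small {n H T : ℕ} {β₁ r κ : ℝ} (hn : 3 ≤ n) (hβ₁ : 0 < β₁)
    (hr : β₁ * √(Real.log n / n) ≤ r) (hHr : (H : ℝ) * r ≤ 1) (hH1 : 1 ≤ H) (hH : H ≤ T)
    (hκ0 : 0 < κ) (hκ : κ * (32 * T ^ 2) ≤ 1) (hκn : 1 ≤ κ * (β₁ ^ 2 * Real.log n)) :
    (posLaw n).real {X | (reachCount H r X : ℝ) < κ * (n * (H ^ 2 * r ^ 2)) * n} = 0 := by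
  obtain ⟨hlog, hr0, hnr⟩ := mul_log_le_of_range hn hβ₁ hr
  have hn' : (3 : ℝ) ≤ n := by exact_mod_cast hn
  have hH1' : (1 : ℝ) ≤ H := by exact_mod_cast hH1
  have hH' : (H : ℝ) ≤ T := by exact_mod_cast hH
  have hr1 : r ≤ 1 := by nlinarith
  set M := ⌈3 / r⌉₊ with hM
  have hM0 : 0 < M := Nat.ceil_pos.2 (by positivity)
  have hMr1 : 3 ≤ M * r := by
    have := Nat.le_ceil (3 / r)
    rwa [div_le_iff₀ hr0] at this
  have hMr2 : M * r ≤ 4 := by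
    have := Nat.ceil_lt_add_one (show 0 ≤ 3 / r by positivity)
    have h2 : (M : ℝ) * r ≤ (3 / r + 1) * r := by gcongr
    rw [add_mul, div_mul_cancel₀ _ hr0.ne'] at h2
    linarith
  rw [measureReal_def, measure_eq_zero_iff_ae_notMem.2, ENNReal.toReal_zero]
  filter_upwards [ae_sq_le_reachCount (n := n) hM0 hH1 hMr1] with X hX hlt
  have hMH : M * (H * r) ≤ 4 * T := by
    calc M * (H * r) = M * r * H := by ring
      _ ≤ 4 * T := by gcongr
  refine absurd hX (not_le.2 (lt_of_lt_of_le
    (lt_sq_of_reachCount_lt hn hβ₁ hr hH1 hκ0 hκn hM0 hMH hlt) ?_))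
  calc κ * (2 * (4 * T) ^ 2) * (n : ℝ) ^ 2 = κ * (32 * T ^ 2) * (n : ℝ) ^ 2 := by ring
    _ ≤ 1 * (n : ℝ) ^ 2 := by gcongr
    _ = _ := one_mul _

/-- With high probability, the number of sources in the ad hoc mode is at least of order
`H ^ 2 * log n`. -/
theorem exists_card_adHocSources_lower {β₁ : ℝ} (hβ₁ : 0 < β₁) :
    ∃ (k : ℝ) (e : ℕ → ℝ), 0 < k ∧ Tendsto e atTop (𝓝 0) ∧ ∀ᶠ n : ℕ in atTop, ∀ P : Params,
      1 ≤ P.H → β₁ * √(Real.log n / n) ≤ P.r → (P.H : ℝ) * P.r ≤ 1 →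
      (law n).real {ω : Config n |
        ((adHocSources P ω).card : ℝ) < k * ((P.H : ℝ) ^ 2 * Real.log n)} ≤ e n := by
  obtain ⟨K, hK⟩ := exists_nat_ge (32 / β₁ ^ 2)
  have hKβ : 32 ≤ K * β₁ ^ 2 := by rwa [div_le_iff₀ (by positivity)] at hK
  have hK0 : 0 < K := by
    have : (0 : ℝ) < K := lt_of_lt_of_le (by positivity) hK
    exact_mod_cast this
  have hK1 : (1 : ℝ) ≤ (K : ℝ) ^ 2 := one_le_pow₀ (by exact_mod_cast hK0)
  -- Small enough for both ranges of `H`: `8 * 112 ^ 2` is needed for large `H`, and `32 * (28 * K)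
  -- ^ 2` for `H < 28 * K`.
  set κ : ℝ := 1 / (8 * 112 ^ 2 * K ^ 2) with hκ
  have hκ0 : 0 < κ := by positivity
  have hκK : κ * (8 * 112 ^ 2 * K ^ 2) = 1 := by rw [hκ]; field_simp
  refine ⟨κ * β₁ ^ 2 / 2, fun n => reachError β₁ K n + 4 / (κ * (β₁ ^ 2 * Real.log n)),
    by positivity, ?_, ?_⟩
  · have h2 : Tendsto (fun n : ℕ => 4 / (κ * (β₁ ^ 2 * Real.log n))) atTop (𝓝 0) :=
      tendsto_const_nhds.div_atTop ((tendsto_log_natCast.const_mul_atTop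
        (by positivity)).const_mul_atTop hκ0)
    simpa using (tendsto_reachError hβ₁ K).add h2
  · filter_upwards [eventually_ge_atTop 3, ((tendsto_log_natCast.const_mul_atTop
      (show 0 < β₁ ^ 2 by positivity)).const_mul_atTop hκ0).eventually_ge_atTop 1]
      with n hn hκn P hH hr hHr
    obtain ⟨hlog, hr0, hnr⟩ := mul_log_le_of_range hn hβ₁ hr
    have hn' : (3 : ℝ) ≤ n := by exact_mod_cast hn
    have hH' : (1 : ℝ) ≤ P.H := by exact_mod_cast hH
    have hl1 : β₁ ^ 2 * (P.H ^ 2 * Real.log n) ≤ n * (P.H ^ 2 * P.r ^ 2) := by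
      calc β₁ ^ 2 * (P.H ^ 2 * Real.log n) = P.H ^ 2 * (β₁ ^ 2 * Real.log n) := by ring
        _ ≤ P.H ^ 2 * (n * P.r ^ 2) := by gcongr
        _ = _ := by ring
    have hl2 : β₁ ^ 2 * Real.log n ≤ n * (P.H ^ 2 * P.r ^ 2) := by
      refine le_trans ?_ hl1
      gcongr
      exact le_mul_of_one_le_left (by linarith) (one_le_pow₀ hH')
    have hl0 : 0 < κ * (n * (P.H ^ 2 * P.r ^ 2)) := by positivity
    have := isProbabilityMeasure_law (n := n) (by omega)
    refine (measureReal_mono ?_).trans ((law_real_card_adHocSources_le (by omega) P hl0).trans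
      (add_le_add ?_ ?_))
    · intro ω hω
      simp only [Set.mem_ofPred_eq] at hω ⊢
      refine hω.le.trans ?_
      have := mul_le_mul_of_nonneg_left hl1 hκ0.le
      linarith
    · by_cases hHK : 28 * K ≤ P.H
      · refine posLaw_real_reachCount_lt_of_large hn hβ₁ hr hHr hK0 hKβ hHK hκ0 ?_ hκn
        nlinarith
      · rw [posLaw_real_reachCount_lt_of_small hn hβ₁ hr hHr hH (T := 28 * K) (by omega) hκ0 ?_ hκn]
        · exact reachError_nonneg K n
        · push_cast
          nlinarith
    · gcongr

/-! ### Exchangeability of the nodes -/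

theorem dist_iso {V W : Type*} {G : SimpleGraph V} {G' : SimpleGraph W} (φ : G ≃g G') (u v : V) :
    G'.dist (φ u) (φ v) = G.dist u v := by
  have hle : ∀ {V W : Type _} {G : SimpleGraph V} {G' : SimpleGraph W} (φ : G ≃g G') (u v : V),
      Set.range (SimpleGraph.Walk.length : G.Walk u v → ℕ) ⊆
        Set.range (SimpleGraph.Walk.length : G'.Walk (φ u) (φ v) → ℕ) := by
    rintro V W G G' φ u v _ ⟨p, rfl⟩
    exact ⟨p.map φ.toHom, SimpleGraph.Walk.length_map _ _⟩
  rw [SimpleGraph.dist_eq_sInf, SimpleGraph.dist_eq_sInf]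
  congr 1
  refine Set.Subset.antisymm ?_ (hle φ u v)
  rintro _ ⟨p, rfl⟩
  exact ⟨(p.map φ.symm.toHom).copy (by simp) (by simp), by simp⟩

/-- Relabelling of the nodes. -/
def relabel {n : ℕ} (σ : Equiv.Perm (Fin n)) (ω : Config n) : Config n :=
  (ω.1 ∘ σ, σ.symm ∘ ω.2 ∘ σ)

/-- The relabelling is an isomorphism of the hop graphs. -/
def relabelIso {n : ℕ} (r : ℝ) (σ : Equiv.Perm (Fin n)) (ω : Config n) :
    hopGraph r (relabel σ ω).1 ≃g hopGraph r ω.1 where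
  toEquiv := σ
  map_rel_iff' := by
    intro i j
    simp [hopGraph, relabel]

theorem hops_relabel {n : ℕ} (r : ℝ) (σ : Equiv.Perm (Fin n)) (ω : Config n) (i : Fin n) :
    hops r (relabel σ ω) i = hops r ω (σ i) := by
  have h := dist_iso (relabelIso r σ ω) i ((relabel σ ω).2 i)
  have e : relabelIso r σ ω ((relabel σ ω).2 i) = ω.2 (σ i) := σ.apply_symm_apply _
  rw [e] at h
  exact h.symm

theorem isAdHoc_relabel {n : ℕ} (H : ℕ) (r : ℝ) (σ : Equiv.Perm (Fin n)) (ω : Config n)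
    (i : Fin n) : IsAdHoc H r (relabel σ ω) i ↔ IsAdHoc H r ω (σ i) := by
  constructor
  · rintro ⟨p, hp⟩
    have e1 : (relabelIso r σ ω).toHom i = σ i := rfl
    have e2 : (relabelIso r σ ω).toHom ((relabel σ ω).2 i) = ω.2 (σ i) := σ.apply_symm_apply _
    refine ⟨(p.map (relabelIso r σ ω).toHom).copy e1 e2, ?_⟩
    rwa [SimpleGraph.Walk.length_copy, SimpleGraph.Walk.length_map]
  · rintro ⟨p, hp⟩
    have e1 : (relabelIso r σ ω).symm.toHom (σ i) = i := σ.symm_apply_apply _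
    have e2 : (relabelIso r σ ω).symm.toHom (ω.2 (σ i)) = (relabel σ ω).2 i := rfl
    refine ⟨(p.map (relabelIso r σ ω).symm.toHom).copy e1 e2, ?_⟩
    rwa [SimpleGraph.Walk.length_copy, SimpleGraph.Walk.length_map]

theorem measurePreserving_pos {n : ℕ} (σ : Equiv.Perm (Fin n)) :
    MeasurePreserving (fun X : Fin n → Plane => X ∘ σ) (posLaw n) (posLaw n) := by
  have h : MeasurePreserving (MeasurableEquiv.piCongrLeft (fun _ : Fin n => Plane) σ.symm)
      (posLaw n) (posLaw n) := measurePreserving_piCongrLeft (fun _ : Fin n => squareLaw) σ.symm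
  convert h using 1
  ext X i
  obtain ⟨j, rfl⟩ := σ.symm.surjective i
  simp [MeasurableEquiv.piCongrLeft, Equiv.piCongrLeft_apply_apply]

/-- Conjugation by `σ` permutes the maps without fixed points, so it preserves their counting
measure. -/
theorem measurePreserving_dest {n : ℕ} (σ : Equiv.Perm (Fin n)) :
    MeasurePreserving (fun d : Fin n → Fin n => σ.symm ∘ d ∘ σ) (destLaw n) (destLaw n) := by
  refine ⟨measurable_of_countable _, Measure.ext fun t _ => ?_⟩
  rw [Measure.map_apply (measurable_of_countable _) (Set.toFinite _).measurableSet]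
  unfold destLaw uniformOn
  rw [cond_apply (Set.toFinite _).measurableSet, cond_apply (Set.toFinite _).measurableSet]
  congr 1
  have hS : {d : Fin n → Fin n | ∀ i, d i ≠ i} ∩ (fun d => σ.symm ∘ d ∘ σ) ⁻¹' t =
      (Equiv.conj σ : (Fin n → Fin n) ≃ (Fin n → Fin n)) ''
        ({d : Fin n → Fin n | ∀ i, d i ≠ i} ∩ t) := by
    rw [Equiv.image_eq_preimage_symm]
    ext d
    simp only [Set.mem_inter_iff, Set.mem_ofPred_eq, Set.mem_preimage, Equiv.conj_symm,
      Equiv.conj_apply, Equiv.symm_symm]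
    refine and_congr ⟨fun h i hi => h (σ i) ?_, fun h i hi => h (σ.symm i) ?_⟩ Iff.rfl
    · exact σ.symm_apply_eq.1 hi
    · simp [hi]
  rw [hS, Measure.count_apply (Set.toFinite _).measurableSet,
    Measure.count_apply (Set.toFinite _).measurableSet, (Equiv.injective _).encard_image]

theorem measurePreserving_relabel {n : ℕ} (hn : 2 ≤ n) (σ : Equiv.Perm (Fin n)) :
    MeasurePreserving (relabel σ) (law n) (law n) := by
  have := isProbabilityMeasure_destLaw hn
  exact (measurePreserving_pos σ).prod (measurePreserving_dest σ)

/-! ### The total number of hops -/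

/-- The number of hops of the source `i` if it is in the ad hoc mode. -/
noncomputable def adHocHops {n : ℕ} (P : Params) (i : Fin n) (ω : Config n) : ℝ :=
  {ω | IsAdHoc P.H P.r ω i}.indicator (fun ω => (hops P.r ω i : ℝ)) ω

theorem sum_hops_adHocSources {n : ℕ} (P : Params) (ω : Config n) :
    ∑ i ∈ adHocSources P ω, (hops P.r ω i : ℝ) = ∑ i, adHocHops P i ω := by
  unfold adHocSources
  rw [Finset.sum_filter]
  refine Finset.sum_congr rfl fun i _ => ?_
  by_cases h : IsAdHoc P.H P.r ω i <;> simp [h, adHocHops]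

theorem adHocHops_nonneg {n : ℕ} (P : Params) (i : Fin n) (ω : Config n) :
    0 ≤ adHocHops P i ω := Set.indicator_nonneg (fun _ _ => Nat.cast_nonneg _) _

theorem adHocHops_le {n : ℕ} (P : Params) (i : Fin n) (ω : Config n) :
    adHocHops P i ω ≤ P.H * {ω | IsAdHoc P.H P.r ω i}.indicator (fun _ => (1 : ℝ)) ω := by
  unfold adHocHops
  by_cases h : ω ∈ {ω : Config n | IsAdHoc P.H P.r ω i}
  · rw [Set.indicator_of_mem h, Set.indicator_of_mem h, mul_one]
    exact_mod_cast hops_le h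
  · rw [Set.indicator_of_notMem h, Set.indicator_of_notMem h, mul_zero]

theorem measurable_adHocHops {n : ℕ} (P : Params) (i : Fin n) :
    Measurable (adHocHops P i : Config n → ℝ) :=
  (measurable_from_nat.comp (measurable_hops P.r i)).indicator (measurableSet_isAdHoc P.H P.r i)

theorem integrable_adHocHops {n : ℕ} (hn : 2 ≤ n) (P : Params) (i : Fin n) :
    Integrable (adHocHops P i) (law n) := by
  have := isProbabilityMeasure_law hn
  refine Integrable.of_bound (measurable_adHocHops P i).aestronglyMeasurable P.H
    (Eventually.of_forall fun ω => ?_)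
  rw [Real.norm_of_nonneg (adHocHops_nonneg P i ω)]
  refine (adHocHops_le P i ω).trans (mul_le_of_le_one_right (Nat.cast_nonneg _) ?_)
  exact Set.indicator_apply_le' (fun _ => le_rfl) fun _ => zero_le_one

theorem adHocHops_relabel {n : ℕ} (P : Params) (σ : Equiv.Perm (Fin n)) (i : Fin n)
    (ω : Config n) : adHocHops P i (relabel σ ω) = adHocHops P (σ i) ω := by
  have h := isAdHoc_relabel P.H P.r σ ω i
  by_cases hi : IsAdHoc P.H P.r ω (σ i)
  · have hi' := h.2 hi
    simp only [adHocHops, Set.indicator, Set.mem_ofPred_eq, hi, hi', if_true, hops_relabel]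
  · have hi' := mt h.1 hi
    simp only [adHocHops, Set.indicator, Set.mem_ofPred_eq, hi, hi', if_false]

theorem integral_adHocHops_eq {n : ℕ} (hn : 2 ≤ n) (P : Params) (i j : Fin n) :
    ∫ ω, adHocHops P i ω ∂(law n) = ∫ ω, adHocHops P j ω ∂(law n) := by
  have hmp := measurePreserving_relabel hn (Equiv.swap i j)
  rw [← hmp.map_eq, integral_map hmp.measurable.aemeasurable
    (measurable_adHocHops P i).aestronglyMeasurable, hmp.map_eq]
  refine integral_congr_ae (Eventually.of_forall fun ω => ?_)
  change adHocHops P i (relabel (Equiv.swap i j) ω) = adHocHops P j ω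
  rw [adHocHops_relabel, Equiv.swap_apply_left]

/-- By exchangeability every source has the same mean, so the mean of the total determines that of a
single source. -/
theorem card_mul_integral_adHocHops {n : ℕ} (hn : 2 ≤ n) (P : Params) (i : Fin n) :
    n * ∫ ω, adHocHops P i ω ∂(law n) =
      ∫ ω, ∑ j ∈ adHocSources P ω, (hops P.r ω j : ℝ) ∂(law n) := by
  simp only [sum_hops_adHocSources]
  rw [integral_finsetSum _ fun j _ => integrable_adHocHops hn P j,
    Finset.sum_congr rfl fun j _ => integral_adHocHops_eq hn P j i]
  simp

theorem expectedHops_eq {n : ℕ} (P : Params) (i : Fin n) :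
    expectedHops P i = ((law n).real {ω : Config n | IsAdHoc P.H P.r ω i})⁻¹ *
      ∫ ω, adHocHops P i ω ∂(law n) := by
  unfold expectedHops adHocHops ProbabilityTheory.cond
  rw [integral_smul_measure, integral_indicator (measurableSet_isAdHoc P.H P.r i),
    ENNReal.toReal_inv]
  rfl

theorem isAdHoc_subset_nearEvent {n : ℕ} {P : Params} (hr : 0 ≤ P.r) (i : Fin n) :
    {ω : Config n | IsAdHoc P.H P.r ω i} ⊆ nearEvent (P.H * P.r) i := by
  intro ω hω
  obtain ⟨h1, h2⟩ := dist_le_of_isAdHoc hω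
  refine le_trans h1 ?_
  have : (hops P.r ω i : ℝ) ≤ P.H := by exact_mod_cast h2
  gcongr

theorem law_real_isAdHoc_le {n : ℕ} (hn : 2 ≤ n) {P : Params} (hr : 0 ≤ P.r) (i : Fin n) :
    (law n).real {ω : Config n | IsAdHoc P.H P.r ω i} ≤ Real.pi * (P.H * P.r) ^ 2 := by
  have := isProbabilityMeasure_law hn
  refine (measureReal_mono (isAdHoc_subset_nearEvent hr i)).trans ?_
  rw [law_real_nearEvent hn]
  exact nearProb_le (by positivity)

theorem integral_card_adHocSources {n : ℕ} (hn : 2 ≤ n) (P : Params) :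
    ∫ ω, ((adHocSources P ω).card : ℝ) ∂(law n) =
      ∑ i, (law n).real {ω : Config n | IsAdHoc P.H P.r ω i} := by
  have := isProbabilityMeasure_law hn
  simp only [card_adHocSources]
  rw [integral_finsetSum _ fun i _ => integrable_indicator_one (measurableSet_isAdHoc P.H P.r i)]
  exact Finset.sum_congr rfl fun i _ =>
    integral_indicator_const_one (measurableSet_isAdHoc P.H P.r i)

theorem expectedHops_le {n : ℕ} (hn : 2 ≤ n) (P : Params) (i : Fin n) :
    expectedHops P i ≤ P.H := by
  have := isProbabilityMeasure_law hn
  obtain ⟨p, hp⟩ : ∃ p, p = (law n).real {ω : Config n | IsAdHoc P.H P.r ω i} := ⟨_, rfl⟩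
  have hp0 : 0 ≤ p := hp ▸ measureReal_nonneg
  have hle : ∫ ω, adHocHops P i ω ∂(law n) ≤ P.H * p := by
    rw [hp, ← integral_indicator_const_one (measurableSet_isAdHoc P.H P.r i), ← integral_const_mul]
    exact integral_mono (integrable_adHocHops hn P i)
      ((integrable_indicator_one (measurableSet_isAdHoc P.H P.r i)).const_mul _)
      fun ω => adHocHops_le P i ω
  rw [expectedHops_eq, ← hp]
  -- If the conditioning event is null, the expectation takes the value 0.
  rcases hp0.eq_or_lt with h0 | h0
  · rw [← h0, inv_zero, zero_mul]
    exact Nat.cast_nonneg _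
  · rw [inv_mul_le_iff₀ h0]
    linarith

/-! ### The orders of the quantities of the theorem -/

/-- The assumptions on a network with `n` nodes. -/
structure Regime (β₁ β₂ ε : ℝ) (n : ℕ) (P : Params) : Prop where
  three_le : 3 ≤ n
  one_le_H : 1 ≤ P.H
  one_le_m : 1 ≤ P.m
  even_m : Even P.m
  one_le_CI : 1 ≤ P.CI
  c_pos : 0 < P.c
  c₁_pos : 0 < P.c₁
  le_r : β₁ * √(Real.log n / n) ≤ P.r
  r_le : P.r ≤ β₂ * √(Real.log n / n)
  area_le : Real.pi * (P.H : ℝ) ^ 2 * P.r ^ 2 ≤ 1 - ε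

/-- The quantities of the theorem have the orders claimed there. -/
def Orders (k K : ℝ) {n : ℕ} (P : Params) (ω : Config n) : Prop :=
  Between k K (adHocSources P ω).card ((P.H : ℝ) ^ 2 * Real.log n) ∧
  Between k K (avgHops P ω) P.H ∧
  Between k K (avgDelayAdHoc P ω) ((P.H : ℝ) ^ 3 * Real.log n / n) ∧
  Between k K (avgDelayInfra P ω) (P.c / (min P.CI P.m : ℕ)) ∧
  Between k K (avgDelay P ω)
    ((P.H : ℝ) ^ 3 * Real.log n / n + P.c / (min P.CI P.m : ℕ))

theorem Between.mono {k K k' K' x y : ℝ} (h : Between k K x y) (hy : 0 ≤ y) (hk : k' ≤ k)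
    (hK : K ≤ K') : Between k' K' x y :=
  ⟨(mul_le_mul_of_nonneg_right hk hy).trans h.1, h.2.trans (mul_le_mul_of_nonneg_right hK hy)⟩

theorem Between.add {k K x y x' y' : ℝ} (h : Between k K x y) (h' : Between k K x' y') :
    Between k K (x + x') (y + y') :=
  ⟨by rw [mul_add]; exact add_le_add h.1 h'.1, by rw [mul_add]; exact add_le_add h.2 h'.2⟩

namespace Regime

variable {β₁ β₂ ε : ℝ} {n : ℕ} {P : Params}

theorem two_le (h : Regime β₁ β₂ ε n P) : 2 ≤ n := by have := h.three_le; omega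

theorem three_le_cast (h : Regime β₁ β₂ ε n P) : (3 : ℝ) ≤ n := by exact_mod_cast h.three_le

theorem one_le_H_cast (h : Regime β₁ β₂ ε n P) : (1 : ℝ) ≤ P.H := by exact_mod_cast h.one_le_H

theorem infra_pos (h : Regime β₁ β₂ ε n P) : 0 < P.c / (min P.CI P.m : ℕ) :=
  div_pos h.c_pos (by exact_mod_cast lt_min h.one_le_CI h.one_le_m)

theorem one_le_log (h : Regime β₁ β₂ ε n P) : 1 ≤ Real.log n := by
  have := h.three_le_cast
  rw [Real.le_log_iff_exp_le (by linarith)]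
  linarith [Real.exp_one_lt_d9]

theorem r_pos (h : Regime β₁ β₂ ε n P) (hβ₁ : 0 < β₁) : 0 < P.r :=
  (mul_log_le_of_range h.three_le hβ₁ h.le_r).2.1

theorem mul_sq_le (h : Regime β₁ β₂ ε n P) (hβ₁ : 0 < β₁) :
    n * P.r ^ 2 ≤ β₂ ^ 2 * Real.log n := by
  have hr := h.r_pos hβ₁
  have hn := h.three_le_cast
  have hlog := h.one_le_log
  have h1 : P.r ^ 2 ≤ (β₂ * √(Real.log n / n)) ^ 2 := pow_le_pow_left₀ hr.le h.r_le 2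
  rw [mul_pow, Real.sq_sqrt (by positivity)] at h1
  calc n * P.r ^ 2 ≤ n * (β₂ ^ 2 * (Real.log n / n)) := by gcongr
    _ = _ := by field_simp

/-- The mean is at most `a = π β₂² l² log n`, and exceeding `2 * a` has probability at most `7 / a`.
The condition `1 ≤ l` keeps `a` above a multiple of `log n`, uniformly in `l`. -/
theorem law_real_count_near_le (h : Regime β₁ β₂ ε n P) (hβ₁ : 0 < β₁) {l : ℝ} (hl : 1 ≤ l) :
    (law n).real {ω | 2 * (Real.pi * β₂ ^ 2 * (l ^ 2 * Real.log n)) ≤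
      ∑ i, (nearEvent (l * P.r) i).indicator (fun _ => (1 : ℝ)) ω} ≤
      7 / (Real.pi * β₁ ^ 2 * Real.log n) := by
  have hr := h.r_pos hβ₁
  have hlog := h.one_le_log
  have h1 := h.mul_sq_le hβ₁
  have h2 := (mul_log_le_of_range h.three_le hβ₁ h.le_r).2.2
  have hpi := Real.pi_pos
  obtain ⟨a, ha⟩ : ∃ a, a = Real.pi * β₂ ^ 2 * (l ^ 2 * Real.log n) := ⟨_, rfl⟩
  have ha1 : n * (Real.pi * (l * P.r) ^ 2) ≤ a := by
    calc n * (Real.pi * (l * P.r) ^ 2) = Real.pi * l ^ 2 * (n * P.r ^ 2) := by ring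
      _ ≤ Real.pi * l ^ 2 * (β₂ ^ 2 * Real.log n) := by gcongr
      _ = a := by rw [ha]; ring
  have ha2 : Real.pi * β₁ ^ 2 * Real.log n ≤ a := by
    calc Real.pi * β₁ ^ 2 * Real.log n = Real.pi * 1 ^ 2 * (β₁ ^ 2 * Real.log n) := by ring
      _ ≤ Real.pi * l ^ 2 * (n * P.r ^ 2) := by gcongr
      _ = n * (Real.pi * (l * P.r) ^ 2) := by ring
      _ ≤ a := ha1
  have hb : 0 < Real.pi * β₁ ^ 2 * Real.log n := by positivity
  have ha0 : 0 < a := hb.trans_le ha2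
  rw [← ha, two_mul]
  refine (law_real_count_near_ge_le h.two_le (by positivity) ha1 ha0).trans ?_
  rw [div_le_div_iff₀ (by positivity) hb]
  calc 7 * a * (Real.pi * β₁ ^ 2 * Real.log n) ≤ 7 * a * a := by gcongr
    _ = _ := by ring

theorem eps_lt_one (h : Regime β₁ β₂ ε n P) (hβ₁ : 0 < β₁) : ε < 1 := by
  have hr := h.r_pos hβ₁
  have hH := h.one_le_H_cast
  have : 0 < Real.pi * (P.H : ℝ) ^ 2 * P.r ^ 2 := by positivity
  linarith [h.area_le]

/-- The mean is at most `(1 - ε) * n`; half of the slack `ε * n` is given to the fluctuations, so a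
positive fraction of the sources stays in the infrastructure mode. -/
theorem law_real_count_near_le_of_area (h : Regime β₁ β₂ ε n P) (hβ₁ : 0 < β₁) (hε : 0 < ε) :
    (law n).real {ω | (1 - ε / 2) * n ≤
      ∑ i, (nearEvent (P.H * P.r) i).indicator (fun _ => (1 : ℝ)) ω} ≤ 28 / ε ^ 2 / n := by
  have hr := h.r_pos hβ₁
  have hn := h.three_le_cast
  have hε1 := h.eps_lt_one hβ₁
  have ha : n * (Real.pi * (P.H * P.r) ^ 2) ≤ (1 - ε) * n := by
    calc n * (Real.pi * (P.H * P.r) ^ 2) = (Real.pi * (P.H : ℝ) ^ 2 * P.r ^ 2) * n := by ring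
      _ ≤ _ := by gcongr; exact h.area_le
  have key := law_real_count_near_ge_le (t := ε / 2 * n) h.two_le (by positivity) ha (by positivity)
  rw [show (1 - ε) * n + ε / 2 * n = (1 - ε / 2) * n by ring] at key
  refine key.trans ?_
  rw [show (28 : ℝ) / ε ^ 2 / n = 7 * n / (ε / 2 * n) ^ 2 by field_simp; norm_num]
  gcongr
  nlinarith

theorem H_mul_r_le_one (h : Regime β₁ β₂ ε n P) (hε : 0 < ε) : (P.H : ℝ) * P.r ≤ 1 := by
  have h1 : Real.pi * (P.H * P.r) ^ 2 ≤ 1 := by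
    have := h.area_le
    calc Real.pi * (P.H * P.r) ^ 2 = Real.pi * (P.H : ℝ) ^ 2 * P.r ^ 2 := by ring
      _ ≤ 1 := by linarith
  have h2 : (P.H * P.r) ^ 2 ≤ 1 := by nlinarith [Real.pi_gt_three, sq_nonneg (P.H * P.r)]
  exact (abs_le_one_iff_mul_self_le_one.2 (by rwa [← sq])) |> le_of_abs_le

theorem card_le_count_near (h : Regime β₁ β₂ ε n P) (hβ₁ : 0 < β₁) (ω : Config n) :
    ((adHocSources P ω).card : ℝ) ≤
      ∑ i, (nearEvent (P.H * P.r) i).indicator (fun _ => (1 : ℝ)) ω := by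
  rw [card_adHocSources]
  exact Finset.sum_le_sum fun i _ => Set.indicator_le_indicator_of_subset
    (isAdHoc_subset_nearEvent (h.r_pos hβ₁).le i) (fun _ => zero_le_one) ω

/-- Only sources whose destinations are closer than `x * r` can need at most `x` hops. -/
theorem mul_sub_le_sum_adHocHops (h : Regime β₁ β₂ ε n P) (hβ₁ : 0 < β₁) {x : ℝ} (hx : 0 ≤ x)
    (ω : Config n) :
    x * ((adHocSources P ω).card -
      ∑ i, (nearEvent (x * P.r) i).indicator (fun _ => (1 : ℝ)) ω) ≤ ∑ i, adHocHops P i ω := by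
  rw [card_adHocSources, ← Finset.sum_sub_distrib, Finset.mul_sum]
  refine Finset.sum_le_sum fun i _ => ?_
  have hnear0 : 0 ≤ (nearEvent (x * P.r) i).indicator (fun _ => (1 : ℝ)) ω :=
    Set.indicator_nonneg (fun _ _ => zero_le_one) _
  by_cases hi : ω ∈ {ω : Config n | IsAdHoc P.H P.r ω i}
  · rw [adHocHops, Set.indicator_of_mem hi, Set.indicator_of_mem hi]
    by_cases hx' : x ≤ hops P.r ω i
    · nlinarith
    · have hn : ω ∈ nearEvent (x * P.r) i := by
        refine (dist_le_of_isAdHoc hi).1.trans ?_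
        have := h.r_pos hβ₁
        gcongr
        exact (not_le.1 hx').le
      rw [Set.indicator_of_mem hn, sub_self, mul_zero]
      exact Nat.cast_nonneg _
  · rw [adHocHops, Set.indicator_of_notMem hi, Set.indicator_of_notMem hi]
    nlinarith

theorem card_le_sum_adHocHops {ω : Config n} (hd : ∀ i, ω.2 i ≠ i) :
    ((adHocSources P ω).card : ℝ) ≤ ∑ i, adHocHops P i ω := by
  rw [card_adHocSources]
  refine Finset.sum_le_sum fun i _ => ?_
  by_cases hi : ω ∈ {ω : Config n | IsAdHoc P.H P.r ω i}
  · rw [adHocHops, Set.indicator_of_mem hi, Set.indicator_of_mem hi]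
    exact_mod_cast one_le_hops hi (hd i)
  · rw [adHocHops, Set.indicator_of_notMem hi, Set.indicator_of_notMem hi]

theorem sum_adHocHops_le (P : Params) (ω : Config n) :
    ∑ i, adHocHops P i ω ≤ P.H * (adHocSources P ω).card := by
  rw [card_adHocSources, Finset.mul_sum]
  exact Finset.sum_le_sum fun i _ => adHocHops_le P i ω

/-- No probability enters here: all orders follow from two-sided bounds on the number of ad hoc
sources, its distance from `n`, and a lower bound on the total number of hops. -/
theorem orders (h : Regime β₁ β₂ ε n P) {k₀ δ U k K : ℝ} {ω : Config n} (hk₀ : 0 < k₀)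
    (hδ : 0 < δ) (hk1 : k ≤ k₀) (hk2 : k ≤ δ / 2) (hk3 : k ≤ P.c₁ * (δ / 2 * k₀)) (hk4 : k ≤ ε / 2)
    (hK1 : U ≤ K) (hK2 : 1 ≤ K) (hK3 : P.c₁ * U ≤ K)
    (hs1 : k₀ * ((P.H : ℝ) ^ 2 * Real.log n) ≤ (adHocSources P ω).card)
    (hs2 : ((adHocSources P ω).card : ℝ) ≤ U * ((P.H : ℝ) ^ 2 * Real.log n))
    (hs3 : ((adHocSources P ω).card : ℝ) ≤ (1 - ε / 2) * n)
    (hh : δ / 2 * P.H * (adHocSources P ω).card ≤ ∑ i, adHocHops P i ω) : Orders k K P ω := by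
  have hn := h.three_le_cast
  have hH := h.one_le_H_cast
  have hlog := h.one_le_log
  have hc₁ := h.c₁_pos
  have hQ := h.infra_pos
  have hh2 := sum_adHocHops_le P ω
  have ha : avgDelayAdHoc P ω = P.c₁ * (∑ i, adHocHops P i ω) / n := by
    rw [avgDelayAdHoc_eq, sum_hops_adHocSources]
  have hi : avgDelayInfra P ω = (n - (adHocSources P ω).card) / n * (P.c / (min P.CI P.m : ℕ)) :=
    avgDelayInfra_eq h.even_m h.one_le_m h.one_le_CI h.c_pos.le
  have hav : avgHops P ω = (∑ i, adHocHops P i ω) / (adHocSources P ω).card := by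
    rw [avgHops, sum_hops_adHocSources]
  unfold Orders
  generalize (P.c / (min P.CI P.m : ℕ) : ℝ) = Q at *
  generalize ((adHocSources P ω).card : ℝ) = s at *
  generalize (∑ i, adHocHops P i ω) = t at *
  have hx : 0 < (P.H : ℝ) ^ 2 * Real.log n := by positivity
  have hs0 : 0 < s := lt_of_lt_of_le (by positivity) hs1
  have hy : 0 ≤ (P.H : ℝ) ^ 3 * Real.log n / n := by positivity
  have hD : Between k K (avgDelayAdHoc P ω) ((P.H : ℝ) ^ 3 * Real.log n / n) := by
    rw [ha]
    refine Between.mono (k := P.c₁ * (δ / 2 * k₀)) (K := P.c₁ * U) ⟨?_, ?_⟩ hy hk3 hK3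
    · rw [mul_div_assoc']
      refine div_le_div_of_nonneg_right ?_ (by linarith)
      calc P.c₁ * (δ / 2 * k₀) * ((P.H : ℝ) ^ 3 * Real.log n)
          = P.c₁ * (δ / 2 * P.H * (k₀ * ((P.H : ℝ) ^ 2 * Real.log n))) := by ring
        _ ≤ P.c₁ * (δ / 2 * P.H * s) := by gcongr
        _ ≤ P.c₁ * t := by gcongr
    · rw [mul_div_assoc']
      refine div_le_div_of_nonneg_right ?_ (by linarith)
      calc P.c₁ * t ≤ P.c₁ * (P.H * s) := by gcongr
        _ ≤ P.c₁ * (P.H * (U * ((P.H : ℝ) ^ 2 * Real.log n))) := by gcongr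
        _ = P.c₁ * U * ((P.H : ℝ) ^ 3 * Real.log n) := by ring
  have hI : Between k K (avgDelayInfra P ω) Q := by
    rw [hi]
    refine Between.mono (k := ε / 2) (K := 1) ⟨?_, ?_⟩ hQ.le hk4 hK2
    · refine mul_le_mul_of_nonneg_right ?_ hQ.le
      rw [le_div_iff₀ (by linarith)]
      linarith
    · refine mul_le_mul_of_nonneg_right ?_ hQ.le
      rw [div_le_one (by linarith)]
      linarith
  refine ⟨⟨?_, ?_⟩, ?_, hD, hI, ?_⟩
  · exact (mul_le_mul_of_nonneg_right hk1 hx.le).trans hs1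
  · exact hs2.trans (mul_le_mul_of_nonneg_right hK1 hx.le)
  · rw [hav]
    refine Between.mono (k := δ / 2) (K := 1) ⟨?_, ?_⟩ (by linarith) hk2 hK2
    · rwa [le_div_iff₀ hs0]
    · rw [div_le_iff₀ hs0, one_mul]
      exact hh2
  · rw [avgDelay_eq]
    exact hD.add hI

theorem law_real_not_orders_le (h : Regime β₁ β₂ ε n P) (hβ₁ : 0 < β₁) (hε : 0 < ε)
    {k₀ δ U k K e : ℝ} (hk₀ : 0 < k₀)
    (hδ : 0 < δ) (hk1 : k ≤ k₀) (hk2 : k ≤ δ / 2) (hk3 : k ≤ P.c₁ * (δ / 2 * k₀)) (hk4 : k ≤ ε / 2)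
    (hK1 : U ≤ K) (hK2 : 1 ≤ K) (hK3 : P.c₁ * U ≤ K) (hU : 2 * (Real.pi * β₂ ^ 2) ≤ U)
    (hδk : 2 * (Real.pi * β₂ ^ 2) * δ ^ 2 ≤ k₀ / 2)
    (he : (law n).real {ω : Config n |
        ((adHocSources P ω).card : ℝ) < k₀ * ((P.H : ℝ) ^ 2 * Real.log n)} ≤ e) :
    (law n).real {ω : Config n | ¬ Orders k K P ω} ≤
      e + (7 / (Real.pi * β₁ ^ 2 * Real.log n) + (28 / ε ^ 2 / n +
        7 / (Real.pi * β₁ ^ 2 * Real.log n))) := by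
  have := isProbabilityMeasure_law h.two_le
  have hH := h.one_le_H_cast
  have hlog := h.one_le_log
  set B1 := {ω : Config n | ((adHocSources P ω).card : ℝ) < k₀ * ((P.H : ℝ) ^ 2 * Real.log n)}
  set B2 := {ω : Config n | 2 * (Real.pi * β₂ ^ 2 * ((P.H : ℝ) ^ 2 * Real.log n)) ≤
      ∑ i, (nearEvent (P.H * P.r) i).indicator (fun _ => (1 : ℝ)) ω} with hB2
  set B3 := {ω : Config n | (1 - ε / 2) * n ≤
      ∑ i, (nearEvent (P.H * P.r) i).indicator (fun _ => (1 : ℝ)) ω} with hB3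
  -- For `δ * H < 1` this event is empty: every ad hoc source needs at least one hop anyway, because
  -- its destination differs from it.
  set B4 := {ω : Config n | 1 ≤ δ * P.H ∧ 2 * (Real.pi * β₂ ^ 2 * ((δ * P.H) ^ 2 * Real.log n)) ≤
      ∑ i, (nearEvent (δ * P.H * P.r) i).indicator (fun _ => (1 : ℝ)) ω} with hB4
  have h4 : (law n).real B4 ≤ 7 / (Real.pi * β₁ ^ 2 * Real.log n) := by
    by_cases hδH : 1 ≤ δ * P.H
    · refine (measureReal_mono ?_).trans (h.law_real_count_near_le hβ₁ hδH)
      exact fun ω hω => hω.2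
    · have : B4 = ∅ := Set.eq_empty_of_forall_notMem fun ω hω => hδH hω.1
      rw [this, measureReal_empty]
      positivity
  have hsub : (law n).real {ω : Config n | ¬ Orders k K P ω} ≤
      (law n).real (B1 ∪ (B2 ∪ (B3 ∪ B4))) := by
    refine ENNReal.toReal_mono (measure_ne_top _ _) (measure_mono_ae ?_)
    filter_upwards [ae_law_dest_ne h.two_le] with ω hd
    intro hω
    by_contra hnot
    have hnot' : ¬ (ω ∈ B1 ∨ ω ∈ B2 ∨ ω ∈ B3 ∨ ω ∈ B4) := hnot
    simp only [not_or] at hnot'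
    obtain ⟨h1, h2, h3, h4⟩ := hnot'
    simp only [B1, hB2, hB3, hB4, Set.mem_ofPred_eq, not_lt, not_le, not_and] at h1 h2 h3 h4
    have hcard := h.card_le_count_near hβ₁ ω
    refine hω (h.orders hk₀ hδ hk1 hk2 hk3 hk4 hK1 hK2 hK3 h1 ?_ (hcard.trans h3.le) ?_)
    · refine hcard.trans (h2.le.trans ?_)
      calc 2 * (Real.pi * β₂ ^ 2 * ((P.H : ℝ) ^ 2 * Real.log n))
          = 2 * (Real.pi * β₂ ^ 2) * ((P.H : ℝ) ^ 2 * Real.log n) := by ring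
        _ ≤ _ := by gcongr
    · have hs0 : (0 : ℝ) ≤ (adHocSources P ω).card := Nat.cast_nonneg _
      by_cases hδH : 1 ≤ δ * P.H
      · refine le_trans ?_ (h.mul_sub_le_sum_adHocHops hβ₁ (x := δ * P.H) (by positivity) ω)
        have h5 := h4 hδH
        -- By the choice of `δ`, at most half of the ad hoc sources have destinations within `δ * H
        -- * r`; the others need more than `δ * H` hops.
        have h6 : 2 * (Real.pi * β₂ ^ 2 * ((δ * P.H) ^ 2 * Real.log n)) ≤
            (adHocSources P ω).card / 2 := by
          calc 2 * (Real.pi * β₂ ^ 2 * ((δ * P.H) ^ 2 * Real.log n))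
              = 2 * (Real.pi * β₂ ^ 2) * δ ^ 2 * ((P.H : ℝ) ^ 2 * Real.log n) := by ring
            _ ≤ k₀ / 2 * ((P.H : ℝ) ^ 2 * Real.log n) := by gcongr
            _ ≤ _ := by linarith
        calc δ / 2 * P.H * (adHocSources P ω).card
            = δ * P.H * ((adHocSources P ω).card / 2) := by ring
          _ ≤ _ := by
            gcongr
            linarith
      · refine le_trans ?_ (card_le_sum_adHocHops hd)
        refine mul_le_of_le_one_left hs0 ?_
        linarith
  refine hsub.trans ((measureReal_union_le _ _).trans (add_le_add he ?_))
  refine (measureReal_union_le _ _).trans (add_le_add (h.law_real_count_near_le hβ₁ hH) ?_)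
  exact (measureReal_union_le _ _).trans
    (add_le_add (h.law_real_count_near_le_of_area hβ₁ hε) h4)

/-! ### Expectations -/

/-- Markov's inequality read backwards. Subadditivity of the measure replaces the complement rule,
so `G` need not be measurable. -/
theorem half_le_integral (h : Regime β₁ β₂ ε n P) {f : Config n → ℝ} (hf0 : ∀ ω, 0 ≤ f ω)
    (hf : Integrable f (law n)) {G : Config n → Prop} (hG : (law n).real {ω | ¬ G ω} ≤ 1 / 2)
    {v : ℝ} (hv : 0 ≤ v) (hGv : ∀ ω, G ω → v ≤ f ω) : v / 2 ≤ ∫ ω, f ω ∂(law n) := by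
  have := isProbabilityMeasure_law h.two_le
  have h1 := mul_meas_ge_le_integral_of_nonneg (Eventually.of_forall hf0) hf v
  have h2 : 1 ≤ (law n).real {ω | v ≤ f ω} + (law n).real {ω | ¬ G ω} := by
    rw [← probReal_univ (μ := law n)]
    refine (measureReal_mono ?_).trans (measureReal_union_le _ _)
    intro ω _
    by_cases hω : G ω
    · exact Or.inl (hGv ω hω)
    · exact Or.inr hω
  have h3 : v * (1 / 2) ≤ v * (law n).real {ω | v ≤ f ω} :=
    mul_le_mul_of_nonneg_left (by linarith) hv
  linarith

theorem integrable_card (h : Regime β₁ β₂ ε n P) :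
    Integrable (fun ω : Config n => ((adHocSources P ω).card : ℝ)) (law n) := by
  have := isProbabilityMeasure_law h.two_le
  simp only [card_adHocSources]
  exact integrable_finsetSum _ fun i _ => integrable_indicator_one (measurableSet_isAdHoc P.H P.r i)

theorem integrable_avgDelayAdHoc (h : Regime β₁ β₂ ε n P) :
    Integrable (fun ω : Config n => avgDelayAdHoc P ω) (law n) := by
  simp only [avgDelayAdHoc_eq, sum_hops_adHocSources]
  exact ((integrable_finsetSum _ fun i _ => integrable_adHocHops h.two_le P i).const_mul _).div_const _

theorem integrable_avgDelayInfra (h : Regime β₁ β₂ ε n P) :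
    Integrable (fun ω : Config n => avgDelayInfra P ω) (law n) := by
  have := isProbabilityMeasure_law h.two_le
  simp only [avgDelayInfra_eq h.even_m h.one_le_m h.one_le_CI h.c_pos.le]
  exact (((integrable_const _).sub h.integrable_card).div_const _).mul_const _

theorem integral_card_le (h : Regime β₁ β₂ ε n P) (hβ₁ : 0 < β₁) :
    ∫ ω, ((adHocSources P ω).card : ℝ) ∂(law n) ≤
      Real.pi * β₂ ^ 2 * ((P.H : ℝ) ^ 2 * Real.log n) := by
  have hr := h.r_pos hβ₁
  have hpi := Real.pi_pos
  rw [integral_card_adHocSources h.two_le]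
  calc _ ≤ ∑ _i : Fin n, Real.pi * (P.H * P.r) ^ 2 :=
        Finset.sum_le_sum fun i _ => law_real_isAdHoc_le h.two_le hr.le i
    _ = Real.pi * (P.H : ℝ) ^ 2 * (n * P.r ^ 2) := by
        rw [Finset.sum_const, Finset.card_univ, Fintype.card_fin, nsmul_eq_mul]
        ring
    _ ≤ Real.pi * (P.H : ℝ) ^ 2 * (β₂ ^ 2 * Real.log n) :=
        mul_le_mul_of_nonneg_left (h.mul_sq_le hβ₁) (by positivity)
    _ = _ := by ring

theorem avgDelayAdHoc_nonneg (h : Regime β₁ β₂ ε n P) (ω : Config n) : 0 ≤ avgDelayAdHoc P ω := by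
  have hc₁ := h.c₁_pos
  rw [avgDelayAdHoc_eq]
  positivity

theorem avgDelayInfra_nonneg (h : Regime β₁ β₂ ε n P) (ω : Config n) :
    0 ≤ avgDelayInfra P ω := by
  have hn := h.three_le_cast
  rw [avgDelayInfra_eq h.even_m h.one_le_m h.one_le_CI h.c_pos.le]
  have : ((adHocSources P ω).card : ℝ) ≤ n := by
    exact_mod_cast (Finset.card_le_univ _).trans (Fintype.card_fin n).le
  exact mul_nonneg (div_nonneg (by linarith) (by linarith)) h.infra_pos.le

theorem avgDelayInfra_le (h : Regime β₁ β₂ ε n P) (ω : Config n) :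
    avgDelayInfra P ω ≤ P.c / (min P.CI P.m : ℕ) := by
  have hn := h.three_le_cast
  rw [avgDelayInfra_eq h.even_m h.one_le_m h.one_le_CI h.c_pos.le]
  refine mul_le_of_le_one_left h.infra_pos.le ?_
  rw [div_le_one (by linarith)]
  linarith [(Nat.cast_nonneg _ : (0 : ℝ) ≤ (adHocSources P ω).card)]

theorem integral_avgDelayAdHoc_le (h : Regime β₁ β₂ ε n P) (hβ₁ : 0 < β₁) :
    ∫ ω, avgDelayAdHoc P ω ∂(law n) ≤
      P.c₁ * (Real.pi * β₂ ^ 2) * ((P.H : ℝ) ^ 3 * Real.log n / n) := by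
  have hc₁ := h.c₁_pos
  calc ∫ ω, avgDelayAdHoc P ω ∂(law n)
      ≤ ∫ ω, P.c₁ * P.H / n * ((adHocSources P ω).card : ℝ) ∂(law n) := by
        refine integral_mono h.integrable_avgDelayAdHoc (h.integrable_card.const_mul _) fun ω => ?_
        dsimp only
        rw [avgDelayAdHoc_eq, sum_hops_adHocSources, div_mul_eq_mul_div, mul_assoc]
        gcongr
        exact sum_adHocHops_le P ω
    _ ≤ P.c₁ * P.H / n * (Real.pi * β₂ ^ 2 * ((P.H : ℝ) ^ 2 * Real.log n)) := by
        rw [integral_const_mul]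
        gcongr
        exact h.integral_card_le hβ₁
    _ = _ := by ring

/-- The conditional mean is `I / p`, where `I` is the mean number of ad hoc hops of `i` and `p` its
probability of being ad hoc. Exchangeability bounds `I` below by the mean delay, and the disc area
bounds `p` above. -/
theorem le_expectedHops (h : Regime β₁ β₂ ε n P) (hβ₁ : 0 < β₁) {k V : ℝ} (hk : 0 < k)
    (hV : Real.pi * β₂ ^ 2 < V)
    (hD : k * ((P.H : ℝ) ^ 3 * Real.log n / n) ≤ ∫ ω, avgDelayAdHoc P ω ∂(law n)) (i : Fin n) :
    k / (P.c₁ * V) * P.H ≤ expectedHops P i := by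
  have hn := h.three_le_cast
  have hH := h.one_le_H_cast
  have hlog := h.one_le_log
  have hc₁ := h.c₁_pos
  have hr := h.r_pos hβ₁
  have hV0 : 0 < V := lt_of_le_of_lt (by positivity) hV
  have h1 : ∫ ω, avgDelayAdHoc P ω ∂(law n) = P.c₁ * ∫ ω, adHocHops P i ω ∂(law n) := by
    simp only [avgDelayAdHoc_eq]
    rw [integral_div, integral_const_mul, ← card_mul_integral_adHocHops h.two_le P i]
    field_simp
  obtain ⟨p, hp⟩ : ∃ p, p = (law n).real {ω : Config n | IsAdHoc P.H P.r ω i} := ⟨_, rfl⟩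
  have hp0 : 0 ≤ p := hp ▸ measureReal_nonneg
  have hpn : n * p ≤ V * ((P.H : ℝ) ^ 2 * Real.log n) := by
    calc n * p ≤ n * (Real.pi * (P.H * P.r) ^ 2) := by
          gcongr
          rw [hp]
          exact law_real_isAdHoc_le h.two_le hr.le i
      _ = Real.pi * (P.H : ℝ) ^ 2 * (n * P.r ^ 2) := by ring
      _ ≤ Real.pi * (P.H : ℝ) ^ 2 * (β₂ ^ 2 * Real.log n) :=
          mul_le_mul_of_nonneg_left (h.mul_sq_le hβ₁) (by positivity)
      _ = Real.pi * β₂ ^ 2 * ((P.H : ℝ) ^ 2 * Real.log n) := by ring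
      _ ≤ _ := by gcongr
  have hint : ∫ ω, adHocHops P i ω ∂(law n) ≤ P.H * p := by
    rw [hp, ← integral_indicator_const_one (measurableSet_isAdHoc P.H P.r i), ← integral_const_mul]
    have := isProbabilityMeasure_law h.two_le
    exact integral_mono (integrable_adHocHops h.two_le P i)
      ((integrable_indicator_one (measurableSet_isAdHoc P.H P.r i)).const_mul _)
      fun ω => adHocHops_le P i ω
  rw [h1] at hD
  rw [expectedHops_eq, ← hp]
  generalize ∫ ω, adHocHops P i ω ∂(law n) = I at *
  -- A null event would force `I ≤ 0`, against the positive lower bound `hD`.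
  have hp1 : 0 < p := by
    refine hp0.lt_of_ne fun h0 => ?_
    rw [← h0, mul_zero] at hint
    have h2 : 0 < k * ((P.H : ℝ) ^ 3 * Real.log n / n) := by positivity
    nlinarith
  rw [le_inv_mul_iff₀ hp1, div_mul_eq_mul_div, mul_div_assoc', div_le_iff₀ (by positivity)]
  have h3 : k * ((P.H : ℝ) ^ 3 * Real.log n) ≤ P.c₁ * I * n := by
    rwa [mul_div_assoc', div_le_iff₀ (by linarith)] at hD
  have h4 : (n : ℝ) * (p * (k * P.H)) ≤ n * (I * (P.c₁ * V)) := by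
    calc (n : ℝ) * (p * (k * P.H)) = k * P.H * (n * p) := by ring
      _ ≤ k * P.H * (V * ((P.H : ℝ) ^ 2 * Real.log n)) := by gcongr
      _ = V * (k * ((P.H : ℝ) ^ 3 * Real.log n)) := by ring
      _ ≤ V * (P.c₁ * I * n) := by gcongr
      _ = _ := by ring
  exact le_of_mul_le_mul_left h4 (by linarith)

/-- The orders of the expectations follow from the orders with probability at least `1 / 2`. -/
theorem expectations (h : Regime β₁ β₂ ε n P) (hβ₁ : 0 < β₁) {k k' K K' V : ℝ} (hk : 0 < k)
    (hV : Real.pi * β₂ ^ 2 < V) (hk1 : k' ≤ k / 2) (hk2 : k' ≤ k / 2 / (P.c₁ * V))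
    (hK1 : V ≤ K) (hK2 : 1 ≤ K) (hK3 : P.c₁ * V ≤ K)
    (hG : (law n).real {ω : Config n | ¬ Orders k K' P ω} ≤ 1 / 2) :
    (∀ i : Fin n, Between k' K (expectedHops P i) P.H) ∧
    Between k' K (∫ ω, ((adHocSources P ω).card : ℝ) ∂(law n)) ((P.H : ℝ) ^ 2 * Real.log n) ∧
    Between k' K (∫ ω, avgDelayAdHoc P ω ∂(law n)) ((P.H : ℝ) ^ 3 * Real.log n / n) ∧
    Between k' K (∫ ω, avgDelayInfra P ω ∂(law n)) (P.c / (min P.CI P.m : ℕ)) ∧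
    Between k' K (∫ ω, avgDelay P ω ∂(law n))
      ((P.H : ℝ) ^ 3 * Real.log n / n + P.c / (min P.CI P.m : ℕ)) := by
  have := isProbabilityMeasure_law h.two_le
  have hn := h.three_le_cast
  have hH := h.one_le_H_cast
  have hlog := h.one_le_log
  have hc₁ := h.c₁_pos
  have hQ := h.infra_pos
  have hx : 0 ≤ (P.H : ℝ) ^ 2 * Real.log n := by positivity
  have hy : 0 ≤ (P.H : ℝ) ^ 3 * Real.log n / n := by positivity
  have hcard := h.half_le_integral (fun ω => Nat.cast_nonneg _) h.integrable_card hG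
    (mul_nonneg hk.le hx) fun ω hω => hω.1.1
  have hadhoc := h.half_le_integral h.avgDelayAdHoc_nonneg h.integrable_avgDelayAdHoc hG
    (mul_nonneg hk.le hy) fun ω hω => hω.2.2.1.1
  have hinfra := h.half_le_integral h.avgDelayInfra_nonneg h.integrable_avgDelayInfra hG
    (mul_nonneg hk.le hQ.le) fun ω hω => hω.2.2.2.1.1
  have hA : Between k' K (∫ ω, avgDelayAdHoc P ω ∂(law n)) ((P.H : ℝ) ^ 3 * Real.log n / n) := by
    refine Between.mono (k := k / 2) (K := P.c₁ * V) ⟨by linarith, ?_⟩ hy hk1 hK3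
    refine (h.integral_avgDelayAdHoc_le hβ₁).trans ?_
    gcongr
  have hI : Between k' K (∫ ω, avgDelayInfra P ω ∂(law n)) (P.c / (min P.CI P.m : ℕ)) := by
    refine Between.mono (k := k / 2) (K := 1) ⟨by linarith, ?_⟩ hQ.le hk1 hK2
    rw [one_mul]
    refine (integral_mono h.integrable_avgDelayInfra (integrable_const _)
      h.avgDelayInfra_le).trans (le_of_eq ?_)
    simp
  refine ⟨fun i => ?_, ?_, hA, hI, ?_⟩
  · refine Between.mono (k := k / 2 / (P.c₁ * V)) (K := 1) ⟨?_, ?_⟩ (by linarith) hk2 hK2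
    · exact h.le_expectedHops hβ₁ (half_pos hk) hV (by linarith) i
    · rw [one_mul]
      exact expectedHops_le h.two_le P i
  · refine Between.mono (k := k / 2) (K := V) ⟨by linarith, ?_⟩ hx hk1 hK1
    refine (h.integral_card_le hβ₁).trans ?_
    gcongr
  · simp only [avgDelay_eq]
    rw [integral_add h.integrable_avgDelayAdHoc h.integrable_avgDelayInfra]
    exact hA.add hI

end Regime

end MCIS

/-! ### Choice of the constants and conclusion -/

theorem theorem2 (β₁ β₂ ε c₁ : ℝ) (hβ₁ : 0 < β₁) (hε : 0 < ε) (hc₁ : 0 < c₁) :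
    ∃ k K : ℝ, 0 < k ∧ 0 < K ∧
      ∀ (c : ℝ) (P : ℕ → MCIS.Params), 0 < c →
        (∀ n, (P n).c₁ = c₁ ∧ (P n).c = c) →
        (∀ n, 1 ≤ (P n).H ∧ 1 ≤ (P n).b₀ ∧ 1 ≤ (P n).m ∧ Even (P n).m ∧ 1 ≤ (P n).CI) →
        (∀ᶠ n : ℕ in atTop,
          β₁ * √(Real.log n / n) ≤ (P n).r ∧ (P n).r ≤ β₂ * √(Real.log n / n)) →
        (∀ᶠ n : ℕ in atTop, Real.pi * ((P n).H : ℝ) ^ 2 * (P n).r ^ 2 ≤ 1 - ε) →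
        -- the average delay splits into the two contributions
        (∀ (n : ℕ) (ω : MCIS.Config n), MCIS.avgDelay (P n) ω =
          MCIS.avgDelayAdHoc (P n) ω + MCIS.avgDelayInfra (P n) ω) ∧
        -- a base station supports at most `min {C_I, m}` simultaneous transmissions, and this
        -- determines the delay of the packets in the infrastructure mode
        (∀ n, IsGreatest {s | MCIS.CanSupport (P n).m (P n).CI s} (min (P n).CI (P n).m)) ∧
        (∀ (n : ℕ) (ω : MCIS.Config n) (i : Fin n), ¬ MCIS.IsAdHoc (P n).H (P n).r ω i →
          MCIS.packetDelay (P n) ω i = c / (min (P n).CI (P n).m : ℕ)) ∧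
        -- the orders with high probability
        Tendsto (fun n : ℕ => MCIS.law n {ω |
            MCIS.Between k K (MCIS.adHocSources (P n) ω).card (((P n).H : ℝ) ^ 2 * Real.log n) ∧
            MCIS.Between k K (MCIS.avgHops (P n) ω) (P n).H ∧
            MCIS.Between k K (MCIS.avgDelayAdHoc (P n) ω)
              (((P n).H : ℝ) ^ 3 * Real.log n / n) ∧
            MCIS.Between k K (MCIS.avgDelayInfra (P n) ω)
              (c / (min (P n).CI (P n).m : ℕ)) ∧
            MCIS.Between k K (MCIS.avgDelay (P n) ω)
              (((P n).H : ℝ) ^ 3 * Real.log n / n + c / (min (P n).CI (P n).m : ℕ))})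
          atTop (𝓝 1) ∧
        -- the orders of the expectations
        (∀ᶠ n : ℕ in atTop,
          (∀ i : Fin n, MCIS.Between k K (MCIS.expectedHops (P n) i) (P n).H) ∧
          MCIS.Between k K (∫ ω, ((MCIS.adHocSources (P n) ω).card : ℝ) ∂(MCIS.law n))
            (((P n).H : ℝ) ^ 2 * Real.log n) ∧
          MCIS.Between k K (∫ ω, MCIS.avgDelayAdHoc (P n) ω ∂(MCIS.law n))
            (((P n).H : ℝ) ^ 3 * Real.log n / n) ∧
          MCIS.Between k K (∫ ω, MCIS.avgDelayInfra (P n) ω ∂(MCIS.law n))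
            (c / (min (P n).CI (P n).m : ℕ)) ∧
          MCIS.Between k K (∫ ω, MCIS.avgDelay (P n) ω ∂(MCIS.law n))
            (((P n).H : ℝ) ^ 3 * Real.log n / n + c / (min (P n).CI (P n).m : ℕ))) := by
  have hpi := Real.pi_pos
  obtain ⟨k₀, e, hk₀, he, hlower⟩ := MCIS.exists_card_adHocSources_lower hβ₁
  -- The added 1 makes `V` positive whatever `β₂` is, and yields `1 ≤ K`.
  obtain ⟨V, hV⟩ : ∃ V, V = Real.pi * β₂ ^ 2 + 1 := ⟨_, rfl⟩
  have hβV : Real.pi * β₂ ^ 2 < V := by linarith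
  have hV1 : 1 ≤ V := by
    have : 0 ≤ Real.pi * β₂ ^ 2 := by positivity
    linarith
  have hV0 : 0 < V := by linarith
  obtain ⟨δ, hδ, hδk⟩ : ∃ δ : ℝ, 0 < δ ∧ 2 * (Real.pi * β₂ ^ 2) * δ ^ 2 ≤ k₀ / 2 := by
    refine ⟨√(k₀ / (4 * V)), by positivity, ?_⟩
    rw [Real.sq_sqrt (by positivity)]
    calc 2 * (Real.pi * β₂ ^ 2) * (k₀ / (4 * V)) ≤ 2 * V * (k₀ / (4 * V)) := by gcongr
      _ = k₀ / 2 := by field_simp; norm_num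
  obtain ⟨k, hk, hk1, hk2, hk3, hk4⟩ : ∃ k : ℝ, 0 < k ∧ k ≤ k₀ ∧ k ≤ δ / 2 ∧
      k ≤ c₁ * (δ / 2 * k₀) ∧ k ≤ ε / 2 :=
    ⟨min (min k₀ (δ / 2)) (min (c₁ * (δ / 2 * k₀)) (ε / 2)), by positivity,
      (min_le_left _ _).trans (min_le_left _ _), (min_le_left _ _).trans (min_le_right _ _),
      (min_le_right _ _).trans (min_le_left _ _), (min_le_right _ _).trans (min_le_right _ _)⟩
  -- Passing to expectations costs a factor 2, and dividing by the ad hoc probability costs `c₁ *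
  -- V`; `k'` serves both kinds of statement.
  obtain ⟨k', hk', hk1', hk2'⟩ : ∃ k' : ℝ, 0 < k' ∧ k' ≤ k / 2 ∧ k' ≤ k / 2 / (c₁ * V) :=
    ⟨min (k / 2) (k / 2 / (c₁ * V)), by positivity, min_le_left _ _, min_le_right _ _⟩
  obtain ⟨K, hK1, hK2⟩ : ∃ K : ℝ, 2 * V ≤ K ∧ c₁ * (2 * V) ≤ K :=
    ⟨max (2 * V) (c₁ * (2 * V)), le_max_left _ _, le_max_right _ _⟩
  have hK0 : 1 ≤ K := by linarith
  have hcV : c₁ * V ≤ K := by nlinarith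
  refine ⟨k', K, hk', by linarith, fun c P hc hP hP' hr harea => ?_⟩
  have hreg : ∀ᶠ n : ℕ in atTop, MCIS.Regime β₁ β₂ ε n (P n) := by
    filter_upwards [eventually_ge_atTop 3, hr, harea] with n hn hrn han
    obtain ⟨hH, -, hm, hme, hCI⟩ := hP' n
    exact ⟨hn, hH, hm, hme, hCI, (hP n).2.symm ▸ hc, (hP n).1.symm ▸ hc₁, hrn.1, hrn.2, han⟩
  have hlog := MCIS.tendsto_log_natCast
  have hbad : ∀ᶠ n : ℕ in atTop,
      (MCIS.law n).real {ω : MCIS.Config n | ¬ MCIS.Orders k K (P n) ω} ≤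
        e n + (7 / (Real.pi * β₁ ^ 2 * Real.log n) + (28 / ε ^ 2 / n +
          7 / (Real.pi * β₁ ^ 2 * Real.log n))) := by
    filter_upwards [hreg, hlower] with n hn hln
    have h1 := (hP n).1
    exact hn.law_real_not_orders_le hβ₁ hε hk₀ hδ hk1 hk2 (h1.symm ▸ hk3) hk4 hK1 hK0
      (h1.symm ▸ hK2) (by linarith) hδk
      (hln (P n) hn.one_le_H hn.le_r (hn.H_mul_r_le_one hε))
  have herr : Tendsto (fun n : ℕ => e n + (7 / (Real.pi * β₁ ^ 2 * Real.log n) +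
      (28 / ε ^ 2 / n + 7 / (Real.pi * β₁ ^ 2 * Real.log n)))) atTop (𝓝 0) := by
    have h1 : Tendsto (fun n : ℕ => 7 / (Real.pi * β₁ ^ 2 * Real.log n)) atTop (𝓝 0) :=
      tendsto_const_nhds.div_atTop (hlog.const_mul_atTop (by positivity))
    have h2 : Tendsto (fun n : ℕ => 28 / ε ^ 2 / (n : ℝ)) atTop (𝓝 0) :=
      tendsto_const_nhds.div_atTop tendsto_natCast_atTop_atTop
    simpa using he.add (h1.add (h2.add h1))
  have hbad0 : Tendsto (fun n : ℕ =>
      (MCIS.law n).real {ω : MCIS.Config n | ¬ MCIS.Orders k K (P n) ω}) atTop (𝓝 0) :=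
    tendsto_of_tendsto_of_tendsto_of_le_of_le' tendsto_const_nhds herr
      (Eventually.of_forall fun n => measureReal_nonneg) hbad
  refine ⟨fun n ω => MCIS.avgDelay_eq (P n) ω,
    fun n => MCIS.isGreatest_canSupport (hP' n).2.2.2.1, fun n ω i hi => ?_, ?_, ?_⟩
  · obtain ⟨-, -, hm, hme, hCI⟩ := hP' n
    rw [MCIS.packetDelay_infra hme hm hCI ((hP n).2.symm ▸ hc.le) hi, (hP n).2]
  · have hlow : Tendsto (fun n : ℕ => 1 - ENNReal.ofReal
        ((MCIS.law n).real {ω : MCIS.Config n | ¬ MCIS.Orders k K (P n) ω})) atTop (𝓝 1) := by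
      have := ENNReal.Tendsto.sub (tendsto_const_nhds (x := (1 : ENNReal)) (f := atTop (α := ℕ)))
        (ENNReal.tendsto_ofReal hbad0) (Or.inl ENNReal.one_ne_top)
      simpa using this
    refine tendsto_of_tendsto_of_tendsto_of_le_of_le' hlow tendsto_const_nhds ?_ ?_
    · filter_upwards [hreg] with n hn
      have := MCIS.isProbabilityMeasure_law hn.two_le
      -- The bound `1 ≤ μ A + μ Aᶜ` holds by subadditivity, without measurability of the event.
      rw [ofReal_measureReal, tsub_le_iff_right, ← measure_univ (μ := MCIS.law n)]
      refine (measure_mono ?_).trans (measure_union_le _ _)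
      intro ω _
      by_cases hω : MCIS.Orders k K (P n) ω
      · left
        have hH := hn.one_le_H_cast
        have hl := hn.one_le_log
        have hQ := hn.infra_pos
        have hkk : k' ≤ k := by linarith
        have hy : 0 ≤ ((P n).H : ℝ) ^ 3 * Real.log n / n := by positivity
        unfold MCIS.Orders at hω
        rw [(hP n).2] at hω hQ
        exact ⟨hω.1.mono (by positivity) hkk le_rfl, hω.2.1.mono (by positivity) hkk le_rfl,
          hω.2.2.1.mono hy hkk le_rfl, hω.2.2.2.1.mono hQ.le hkk le_rfl,
          hω.2.2.2.2.mono (by linarith) hkk le_rfl⟩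
      · exact Or.inr hω
    · filter_upwards [hreg] with n hn
      have := MCIS.isProbabilityMeasure_law hn.two_le
      exact prob_le_one
  · filter_upwards [hreg, hbad0.eventually_le_const (show (0 : ℝ) < 1 / 2 by norm_num)] with n hn hG
    have h1 := (hP n).1
    have key := hn.expectations hβ₁ hk hβV hk1' (h1.symm ▸ hk2') (by linarith) hK0
      (h1.symm ▸ hcV) hG
    rwa [(hP n).2] at key
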